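/- Let $I=(0,\infty)$, $\nu\ge -\tfrac12$, $\mu\in\mathbb R$, $0<\theta<\pi$, $\alpha\ge 0$, $A\ge 0$, and let $J_\nu$ be the Bessel function of the first kind. For $t,\omega>0$ put $$K^\theta(t,\omega)=\frac{e^{i(1+\nu)(\theta-\pi/2)}}{(\sin\theta)^{1+\mu}}\,e^{\frac i2(t^2+\omega^2)\cot\theta}\,(t\omega\csc\theta)^{-\mu}J_\nu(t\omega\csc\theta)\,t^{1+2\mu},\qquad K^{-\theta}(\omega,t)=\overline{K^{\theta}(\omega,t)},$$ $$(\mathcal H^{\theta}_{\nu,\mu}f)(\omega)=\int_0^\infty K^\theta(t,\omega)f(t)\,dt,\qquad (\mathcal H^{-\theta}_{\nu,\mu}f)(t)=\int_0^\infty K^{-\theta}(\omega,t)f(\omega)\,d\omega .$$ For a sign $\varepsilon\in\{+1,-1\}$, $k,q\in\mathbb N_0$, $x\in I$ and a smooth $f:I\to\mathbb C$ put $$F^{\varepsilon}_{k,q}f(x)=x^k(x^{-1}D_x)^q\big[e^{\varepsilon\frac i2x^2\cot\theta}x^{\mu-\nu}f(x)\big],$$ and let $0^0=1$. For a nonempty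 set of signs $S\subseteq\{+1,-1\}$ and $\beta,B\ge 0$ define: - $\mathbb H_{1,\alpha,A}(I)$ (with signs $S$): the smooth $f:I\to\mathbb C$ such that for all $\varepsilon\in S$, $q\in\mathbb N_0$, $\delta>0$ $$\|f\|_{\varepsilon,q,\delta}=\sup_{k\in\mathbb N_0,\;x\in I}\frac{|F^{\varepsilon}_{k,q}f(x)|}{(A+\delta)^k\,k^{k\alpha}}<\infty ;$$ - $\mathbb H^{2,\beta,B}(I)$ (with signs $S$): the smooth $f:I\to\mathbb C$ such that for all $\varepsilon\in S$, $k\in\mathbb N_0$, $\sigma>0$ $$\|f\|^{\varepsilon,k,\sigma}=\sup_{q\in\mathbb N_0,\;x\in I}\frac{|F^{\varepsilon}_{k,q}f(x)|}{(B+\sigma)^q\,q^{q\beta}}<\infty ;$$ each with the locally convex topology of its seminorms. **Theorem.** Let $S,T\subseteq\{+1,-1\}$ be nonempty sets of signs; $S$ is used for the first space and $T$ for the second. 1. If $\alpha>0$, or $\theta=\pi/2$, or $T=\{+1\}$, then for every $f\in\mathbb H_{1,\alpha,A}(I)$ the integral defining $(\mathcal H^{-\theta}_{\nu,\mu}f)(t)$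 converges absolutely for every $t>0$, and $\mathcal H^{-\theta}_{\nu,\mu}$ is a continuous linear map from $\mathbb H_{1,\alpha,A}(I)$ into $\mathbb H^{2,\,2\alpha,\,A^2(2e)^{2\alpha}}(I)$. 2. If $\alpha>0$, or $\theta=\pi/2$, or $T=\{-1\}$, the same holds for the forward transform $\mathcal H^{\theta}_{\nu,\mu}$. In particular, for $\alpha>0$ both statements hold when the conditions are imposed for both signs $\pm$ in both spaces. -/

import Mathlib

open scoped ContDiff

noncomputable section

namespace FracHankel

/-- The open half-line `I = (0, ∞)`. -/
abbrev HalfLine : Type := Set.Ioi (0 : ℝ)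

/-- Extension by zero of a function on `I` to the real line. It is only used to take derivatives
at points of the open set `I`, where the choice of extension is irrelevant. -/
def zeroExt (f : HalfLine → ℂ) : ℝ → ℂ :=
  fun x => if h : x ∈ Set.Ioi (0 : ℝ) then f ⟨x, h⟩ else 0

/-- Bessel function of the first kind of real order `ν`, for arguments `z > 0`. -/
def besselJ (ν z : ℝ) : ℝ :=
  ∑' m : ℕ, (-1 : ℝ) ^ m / ((m.factorial : ℝ) * Real.Gamma (m + ν + 1)) *
    (z / 2) ^ (2 * (m : ℝ) + ν)

/-- The constant `C_{ν,μ,θ} = e^{i(1+ν)(θ-π/2)} / (sin θ)^{1+μ}`. -/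
def hankelConst (ν μ θ : ℝ) : ℂ :=
  Complex.exp (Complex.I * (((1 + ν) * (θ - Real.pi / 2) : ℝ) : ℂ)) /
    ((Real.sin θ ^ (1 + μ) : ℝ) : ℂ)

/-- The kernel `K^θ(t, w)` of the fractional Hankel transform, for `0 < θ < π` and `t, w > 0`;
for `θ = π / 2` it reduces to `(tw)^{-μ} J_ν(tw) t^{1+2μ}`. -/
def kernel (ν μ θ t w : ℝ) : ℂ :=
  hankelConst ν μ θ *
    Complex.exp (Complex.I / 2 * (((t ^ 2 + w ^ 2) * Real.cot θ : ℝ) : ℂ)) *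
    (((t * w * (Real.sin θ)⁻¹) ^ (-μ) * besselJ ν (t * w * (Real.sin θ)⁻¹) *
      t ^ (1 + 2 * μ) : ℝ) : ℂ)

/-- The kernel `K^{-θ}` of the inverse transform: the complex conjugate of `K^θ`. -/
def invKernel (ν μ θ w t : ℝ) : ℂ := (starRingEnd ℂ) (kernel ν μ θ w t)

/-- The fractional Hankel transform `(H^θ f)(w) = ∫_0^∞ K^θ(t, w) f(t) dt`. -/
def hankel (ν μ θ : ℝ) (f : HalfLine → ℂ) (w : ℝ) : ℂ :=
  ∫ t in Set.Ioi (0 : ℝ), kernel ν μ θ t w * zeroExt f t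

/-- The inverse fractional Hankel transform `(H^{-θ} f)(t) = ∫_0^∞ K^{-θ}(w, t) f(w) dw`. -/
def invHankel (ν μ θ : ℝ) (f : HalfLine → ℂ) (t : ℝ) : ℂ :=
  ∫ w in Set.Ioi (0 : ℝ), invKernel ν μ θ w t * zeroExt f w

/-- The differential operator `x^{-1} D_x`. -/
def xInvD (g : ℝ → ℂ) : ℝ → ℂ := fun x => (x : ℂ)⁻¹ * deriv g x

/-- The function `e^{± (i/2) x² cot θ} x^{μ-ν} f(x)`, where `ε = ±1` is the sign. -/
def chirp (ν μ θ : ℝ) (ε : ℤˣ) (f : HalfLine → ℂ) : ℝ → ℂ := fun x =>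
  Complex.exp (((ε : ℤ) : ℂ) * (Complex.I / 2) * ((x ^ 2 * Real.cot θ : ℝ) : ℂ)) *
    ((x ^ (μ - ν) : ℝ) : ℂ) * zeroExt f x

/-- `(x^{-1} D_x)^q [e^{± (i/2) x² cot θ} x^{μ-ν} f(x)]`. -/
def chirpDeriv (ν μ θ : ℝ) (ε : ℤˣ) (q : ℕ) (f : HalfLine → ℂ) (x : HalfLine) : ℂ :=
  (xInvD^[q] (chirp ν μ θ ε f)) x

/-- The weight `c^n n^{nγ}` (with the convention `0^0 = 1`). -/
def weight (c γ : ℝ) (n : ℕ) : ℝ := c ^ n * (n : ℝ) ^ ((n : ℝ) * γ)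

/-! ### Linearity of the operators on smooth functions -/

lemma zeroExt_add (f g : HalfLine → ℂ) : zeroExt (f + g) = zeroExt f + zeroExt g := by
  funext x
  by_cases h : x ∈ Set.Ioi (0 : ℝ) <;> simp only [zeroExt, h, dite_true, dite_false, Pi.add_apply,
    add_zero]

lemma zeroExt_smul (c : ℂ) (f : HalfLine → ℂ) : zeroExt (c • f) = c • zeroExt f := by
  funext x
  by_cases h : x ∈ Set.Ioi (0 : ℝ) <;> simp only [zeroExt, h, dite_true, dite_false, Pi.smul_apply,
    smul_zero]

/-- The infinitely differentiable complex-valued functions on `I`. -/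
def smoothFun : Submodule ℂ (HalfLine → ℂ) where
  carrier := {f | ContDiffOn ℝ ∞ (zeroExt f) (Set.Ioi 0)}
  zero_mem' := by
    have : zeroExt 0 = fun _ => 0 := by funext x; simp [zeroExt]
    simp only [Set.mem_ofPred_eq, this]
    exact contDiffOn_const
  add_mem' := by
    intro f g hf hg
    simp only [Set.mem_ofPred_eq, zeroExt_add] at *
    exact hf.add hg
  smul_mem' := by
    intro c f hf
    simp only [Set.mem_ofPred_eq, zeroExt_smul] at *
    exact hf.const_smul c

lemma xInvD_smooth {g : ℝ → ℂ} (hg : ContDiffOn ℝ ∞ g (Set.Ioi 0)) :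
    ContDiffOn ℝ ∞ (xInvD g) (Set.Ioi 0) := by
  have h1 : ContDiffOn ℝ ∞ (deriv g) (Set.Ioi 0) := hg.deriv_of_isOpen isOpen_Ioi le_rfl
  have h2 : ContDiffOn ℝ ∞ (fun x : ℝ => (x : ℂ)⁻¹) (Set.Ioi 0) := by
    refine ContDiffOn.inv Complex.ofRealCLM.contDiff.contDiffOn ?_
    intro x hx
    exact Complex.ofReal_ne_zero.2 (ne_of_gt hx)
  exact h2.mul h1

lemma iter_xInvD_smooth {g : ℝ → ℂ} (hg : ContDiffOn ℝ ∞ g (Set.Ioi 0)) (q : ℕ) :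
    ContDiffOn ℝ ∞ (xInvD^[q] g) (Set.Ioi 0) := by
  induction q with
  | zero => exact hg
  | succ q ih => rw [Function.iterate_succ_apply']; exact xInvD_smooth ih

lemma chirp_smooth (ν μ θ : ℝ) (ε : ℤˣ) {f : HalfLine → ℂ} (hf : f ∈ smoothFun) :
    ContDiffOn ℝ ∞ (chirp ν μ θ ε f) (Set.Ioi 0) := by
  have h1 : ContDiffOn ℝ ∞ (fun x : ℝ => ((x ^ (μ - ν) : ℝ) : ℂ)) (Set.Ioi 0) := by
    refine Complex.ofRealCLM.contDiff.comp_contDiffOn ?_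
    intro x hx
    exact (Real.contDiffAt_rpow_const_of_ne (ne_of_gt hx)).contDiffWithinAt
  have h2 : ContDiff ℝ ∞ (fun x : ℝ =>
      Complex.exp (((ε : ℤ) : ℂ) * (Complex.I / 2) * ((x ^ 2 * Real.cot θ : ℝ) : ℂ))) := by
    exact ContDiff.cexp (contDiff_const.mul (Complex.ofRealCLM.contDiff.comp
      ((contDiff_id.pow 2).mul contDiff_const)))
  exact (h2.contDiffOn.mul h1).mul hf

lemma iter_xInvD_add {g h : ℝ → ℂ} (hg : ContDiffOn ℝ ∞ g (Set.Ioi 0))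
    (hh : ContDiffOn ℝ ∞ h (Set.Ioi 0)) (q : ℕ) :
    Set.EqOn (xInvD^[q] (g + h)) (xInvD^[q] g + xInvD^[q] h) (Set.Ioi 0) := by
  induction q with
  | zero => intro x _; rfl
  | succ q ih =>
    intro x hx
    simp only [Function.iterate_succ_apply', Pi.add_apply]
    have hnhds : Set.Ioi (0 : ℝ) ∈ nhds x := isOpen_Ioi.mem_nhds hx
    have d : ∀ {u : ℝ → ℂ}, ContDiffOn ℝ ∞ u (Set.Ioi 0) → DifferentiableAt ℝ u x := fun hu =>
      (hu.contDiffAt hnhds).differentiableAt (by simp)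
    have e := Filter.EventuallyEq.deriv_eq (Filter.eventuallyEq_of_mem hnhds ih)
    rw [deriv_add (d (iter_xInvD_smooth hg q)) (d (iter_xInvD_smooth hh q))] at e
    simp only [xInvD, e]
    ring

lemma iter_xInvD_smul (c : ℂ) (g : ℝ → ℂ) (q : ℕ) :
    xInvD^[q] (c • g) = c • xInvD^[q] g := by
  induction q with
  | zero => rfl
  | succ q ih =>
    simp only [Function.iterate_succ_apply', ih]
    funext x
    have : deriv (c • xInvD^[q] g) x = c * deriv (xInvD^[q] g) x := by
      exact deriv_const_mul_field c
    simp only [xInvD, this, Pi.smul_apply, smul_eq_mul]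
    ring

/-- For fixed `q` and `x`, the linear functional `f ↦ (x^{-1} D_x)^q [e^{± (i/2) x² cot θ}
x^{μ-ν} f(x)]` on the smooth functions on `I`. -/
def chirpDerivₗ (ν μ θ : ℝ) (ε : ℤˣ) (q : ℕ) (x : HalfLine) : smoothFun →ₗ[ℂ] ℂ where
  toFun f := chirpDeriv ν μ θ ε q f x
  map_add' f g := by
    have e : chirp ν μ θ ε ((f + g : smoothFun) : HalfLine → ℂ)
        = chirp ν μ θ ε f + chirp ν μ θ ε g := by
      funext y
      simp only [chirp, Submodule.coe_add, zeroExt_add, Pi.add_apply]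
      ring
    simp only [chirpDeriv, e]
    exact iter_xInvD_add (chirp_smooth ν μ θ ε f.2) (chirp_smooth ν μ θ ε g.2) q x.2
  map_smul' c f := by
    have e : chirp ν μ θ ε ((c • f : smoothFun) : HalfLine → ℂ) = c • chirp ν μ θ ε f := by
      funext y
      simp only [chirp, Submodule.coe_smul, zeroExt_smul, Pi.smul_apply, smul_eq_mul]
      ring
    simp only [chirpDeriv, e, iter_xInvD_smul, Pi.smul_apply, RingHom.id_apply]

/-- The supremum seminorm `f ↦ sup_i |L_i f|` of a pointwise bounded family of functionals. -/
def supSeminorm {E ι : Type*} [AddCommGroup E] [Module ℂ E] (L : ι → E →ₗ[ℂ] ℂ)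
    (hL : ∀ f, BddAbove (Set.range fun i => ‖L i f‖)) : Seminorm ℂ E :=
  Seminorm.ofSMulLE (fun f => ⨆ i, ‖L i f‖) (by simp)
    (fun f g => by
      refine Real.iSup_le (fun i => ?_)
        (add_nonneg (Real.iSup_nonneg fun _ => norm_nonneg _)
          (Real.iSup_nonneg fun _ => norm_nonneg _))
      rw [map_add]
      exact (norm_add_le _ _).trans (add_le_add (le_ciSup (hL f) i) (le_ciSup (hL g) i)))
    (fun c f => by
      refine Real.iSup_le (fun i => ?_)
        (mul_nonneg (norm_nonneg _) (Real.iSup_nonneg fun _ => norm_nonneg _))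
      rw [map_smul, norm_smul]
      exact mul_le_mul_of_nonneg_left (le_ciSup (hL f) i) (norm_nonneg _))

lemma norm_quot_le {a w C : ℝ} {z : ℂ} (ha : 0 ≤ a) (h : a * ‖z‖ ≤ C * w) :
    ‖((a / w : ℝ) : ℂ) * z‖ ≤ |C| := by
  rw [norm_mul, Complex.norm_real, Real.norm_eq_abs, abs_div, abs_of_nonneg ha, div_mul_eq_mul_div]
  refine div_le_of_le_mul₀ (abs_nonneg _) (abs_nonneg _) ?_
  rw [← abs_mul]
  exact h.trans (le_abs_self _)

/-! ### The spaces

`S` is the set of signs for which the defining inequalities are imposed: `S = Set.univ` imposes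
them for both signs `±`, a singleton imposes them for a single sign. -/

/-- The functions of the space `H_{1,α,A}(I)`: smooth functions `f` on `I` such that, for every
sign in `S`, every `q` and every `δ > 0`, there is a constant `C` with
`|x^k (x^{-1}D_x)^q e^{± (i/2) x² cot θ} x^{μ-ν} f(x)| ≤ C (A+δ)^k k^{kα}` for all `k` and `x`. -/
def H1Submodule (ν μ θ α A : ℝ) (S : Set ℤˣ) : Submodule ℂ smoothFun where
  carrier := {f | ∀ ε ∈ S, ∀ q : ℕ, ∀ δ : ℝ, 0 < δ → ∃ C : ℝ, ∀ (k : ℕ) (x : HalfLine),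
    (x : ℝ) ^ k * ‖chirpDeriv ν μ θ ε q f x‖ ≤ C * weight (A + δ) α k}
  zero_mem' := fun ε _ q _ _ => ⟨0, fun k x => by
    have := map_zero (chirpDerivₗ ν μ θ ε q x)
    change chirpDeriv ν μ θ ε q ((0 : smoothFun) : HalfLine → ℂ) x = 0 at this
    rw [this]; simp⟩
  add_mem' := by
    intro f g hf hg ε hε q δ hδ
    obtain ⟨C, hC⟩ := hf ε hε q δ hδ
    obtain ⟨D, hD⟩ := hg ε hε q δ hδ
    refine ⟨C + D, fun k x => ?_⟩
    have := map_add (chirpDerivₗ ν μ θ ε q x) f g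
    change chirpDeriv ν μ θ ε q ((f + g : smoothFun) : HalfLine → ℂ) x =
      chirpDeriv ν μ θ ε q f x + chirpDeriv ν μ θ ε q g x at this
    rw [this, add_mul]
    refine le_trans ?_ (add_le_add (hC k x) (hD k x))
    rw [← mul_add]
    exact mul_le_mul_of_nonneg_left (norm_add_le _ _) (pow_nonneg (le_of_lt x.2) k)
  smul_mem' := by
    intro c f hf ε hε q δ hδ
    obtain ⟨C, hC⟩ := hf ε hε q δ hδ
    refine ⟨‖c‖ * C, fun k x => ?_⟩
    have := map_smul (chirpDerivₗ ν μ θ ε q x) c f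
    change chirpDeriv ν μ θ ε q ((c • f : smoothFun) : HalfLine → ℂ) x =
      c • chirpDeriv ν μ θ ε q f x at this
    rw [this, norm_smul, mul_left_comm, mul_assoc]
    exact mul_le_mul_of_nonneg_left (hC k x) (norm_nonneg _)

/-- The functions of the space `H^{2,β,B}(I)`: smooth functions `f` on `I` such that, for every
sign in `S`, every `k` and every `σ > 0`, there is a constant `C` with
`|x^k (x^{-1}D_x)^q e^{± (i/2) x² cot θ} x^{μ-ν} f(x)| ≤ C (B+σ)^q q^{qβ}` for all `q` and `x`. -/
def H2Submodule (ν μ θ β B : ℝ) (S : Set ℤˣ) : Submodule ℂ smoothFun where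
  carrier := {f | ∀ ε ∈ S, ∀ k : ℕ, ∀ σ : ℝ, 0 < σ → ∃ C : ℝ, ∀ (q : ℕ) (x : HalfLine),
    (x : ℝ) ^ k * ‖chirpDeriv ν μ θ ε q f x‖ ≤ C * weight (B + σ) β q}
  zero_mem' := fun ε _ k _ _ => ⟨0, fun q x => by
    have := map_zero (chirpDerivₗ ν μ θ ε q x)
    change chirpDeriv ν μ θ ε q ((0 : smoothFun) : HalfLine → ℂ) x = 0 at this
    rw [this]; simp⟩
  add_mem' := by
    intro f g hf hg ε hε k σ hσ
    obtain ⟨C, hC⟩ := hf ε hε k σ hσ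
    obtain ⟨D, hD⟩ := hg ε hε k σ hσ
    refine ⟨C + D, fun q x => ?_⟩
    have := map_add (chirpDerivₗ ν μ θ ε q x) f g
    change chirpDeriv ν μ θ ε q ((f + g : smoothFun) : HalfLine → ℂ) x =
      chirpDeriv ν μ θ ε q f x + chirpDeriv ν μ θ ε q g x at this
    rw [this, add_mul]
    refine le_trans ?_ (add_le_add (hC q x) (hD q x))
    rw [← mul_add]
    exact mul_le_mul_of_nonneg_left (norm_add_le _ _) (pow_nonneg (le_of_lt x.2) k)
  smul_mem' := by
    intro c f hf ε hε k σ hσ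
    obtain ⟨C, hC⟩ := hf ε hε k σ hσ
    refine ⟨‖c‖ * C, fun q x => ?_⟩
    have := map_smul (chirpDerivₗ ν μ θ ε q x) c f
    change chirpDeriv ν μ θ ε q ((c • f : smoothFun) : HalfLine → ℂ) x =
      c • chirpDeriv ν μ θ ε q f x at this
    rw [this, norm_smul, mul_left_comm, mul_assoc]
    exact mul_le_mul_of_nonneg_left (hC q x) (norm_nonneg _)

/-- The space `H_{1,α,A}(I)`, as a type of its own: its topology is not the pointwise one. -/
def H1 (ν μ θ α A : ℝ) (S : Set ℤˣ) : Type := H1Submodule ν μ θ α A S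

/-- The space `H^{2,β,B}(I)`, as a type of its own: its topology is not the pointwise one. -/
def H2 (ν μ θ β B : ℝ) (S : Set ℤˣ) : Type := H2Submodule ν μ θ β B S

instance (ν μ θ α A : ℝ) (S : Set ℤˣ) : AddCommGroup (H1 ν μ θ α A S) :=
  inferInstanceAs (AddCommGroup (H1Submodule ν μ θ α A S))

instance (ν μ θ α A : ℝ) (S : Set ℤˣ) : Module ℂ (H1 ν μ θ α A S) :=
  inferInstanceAs (Module ℂ (H1Submodule ν μ θ α A S))

instance (ν μ θ β B : ℝ) (S : Set ℤˣ) : AddCommGroup (H2 ν μ θ β B S) :=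
  inferInstanceAs (AddCommGroup (H2Submodule ν μ θ β B S))

instance (ν μ θ β B : ℝ) (S : Set ℤˣ) : Module ℂ (H2 ν μ θ β B S) :=
  inferInstanceAs (Module ℂ (H2Submodule ν μ θ β B S))

/-- The underlying smooth function of an element of `H_{1,α,A}(I)`. -/
def H1.toSmooth {ν μ θ α A : ℝ} {S : Set ℤˣ} : H1 ν μ θ α A S →ₗ[ℂ] smoothFun :=
  (H1Submodule ν μ θ α A S).subtype

/-- The underlying smooth function of an element of `H^{2,β,B}(I)`. -/
def H2.toSmooth {ν μ θ β B : ℝ} {S : Set ℤˣ} : H2 ν μ θ β B S →ₗ[ℂ] smoothFun :=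
  (H2Submodule ν μ θ β B S).subtype

instance (ν μ θ α A : ℝ) (S : Set ℤˣ) : CoeFun (H1 ν μ θ α A S) (fun _ => HalfLine → ℂ) :=
  ⟨fun f => (H1.toSmooth f : HalfLine → ℂ)⟩

instance (ν μ θ β B : ℝ) (S : Set ℤˣ) : CoeFun (H2 ν μ θ β B S) (fun _ => HalfLine → ℂ) :=
  ⟨fun f => (H2.toSmooth f : HalfLine → ℂ)⟩

/-- The norms of `H_{1,α,A}(I)`, indexed by the sign, `q ∈ ℕ` and `δ > 0`:
`sup_{k, x} |x^k (x^{-1}D_x)^q e^{± (i/2) x² cot θ} x^{μ-ν} f(x)| / ((A+δ)^k k^{kα})`. -/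
def H1.seminorms (ν μ θ α A : ℝ) (S : Set ℤˣ) :
    SeminormFamily ℂ (H1 ν μ θ α A S) (S × ℕ × Set.Ioi (0 : ℝ)) := fun j =>
  supSeminorm
    (fun i : ℕ × HalfLine =>
      (((i.2 : ℝ) ^ i.1 / weight (A + j.2.2) α i.1 : ℝ) : ℂ) •
        (chirpDerivₗ ν μ θ j.1 j.2.1 i.2).comp H1.toSmooth)
    (fun f => by
      obtain ⟨C, hC⟩ := f.2 j.1 j.1.2 j.2.1 j.2.2 j.2.2.2
      refine ⟨|C|, ?_⟩
      rintro _ ⟨i, rfl⟩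
      exact norm_quot_le (pow_nonneg (le_of_lt i.2.2) _) (hC i.1 i.2))

/-- The norms of `H^{2,β,B}(I)`, indexed by the sign, `k ∈ ℕ` and `σ > 0`:
`sup_{q, x} |x^k (x^{-1}D_x)^q e^{± (i/2) x² cot θ} x^{μ-ν} f(x)| / ((B+σ)^q q^{qβ})`. -/
def H2.seminorms (ν μ θ β B : ℝ) (S : Set ℤˣ) :
    SeminormFamily ℂ (H2 ν μ θ β B S) (S × ℕ × Set.Ioi (0 : ℝ)) := fun j =>
  supSeminorm
    (fun i : ℕ × HalfLine =>
      (((i.2 : ℝ) ^ j.2.1 / weight (B + j.2.2) β i.1 : ℝ) : ℂ) •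
        (chirpDerivₗ ν μ θ j.1 i.1 i.2).comp H2.toSmooth)
    (fun f => by
      obtain ⟨C, hC⟩ := f.2 j.1 j.1.2 j.2.1 j.2.2 j.2.2.2
      refine ⟨|C|, ?_⟩
      rintro _ ⟨i, rfl⟩
      exact norm_quot_le (pow_nonneg (le_of_lt i.2.2) _) (hC i.1 i.2))

/-- The topology of `H_{1,α,A}(I)` defined by its norms. -/
instance (ν μ θ α A : ℝ) (S : Set ℤˣ) : TopologicalSpace (H1 ν μ θ α A S) :=
  (H1.seminorms ν μ θ α A S).moduleFilterBasis.topology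

/-- The topology of `H^{2,β,B}(I)` defined by its norms. -/
instance (ν μ θ β B : ℝ) (S : Set ℤˣ) : TopologicalSpace (H2 ν μ θ β B S) :=
  (H2.seminorms ν μ θ β B S).moduleFilterBasis.topology

lemma H1.withSeminorms (ν μ θ α A : ℝ) (S : Set ℤˣ) :
    WithSeminorms (H1.seminorms ν μ θ α A S) := ⟨rfl⟩

lemma H2.withSeminorms (ν μ θ β B : ℝ) (S : Set ℤˣ) :
    WithSeminorms (H2.seminorms ν μ θ β B S) := ⟨rfl⟩

end FracHankel

end

noncomputable section

namespace FracHankel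

open Filter Topology MeasureTheory Set

/-! ### The normalized Bessel function -/

/-! Write `J_ν(z) = (z/2)^ν G_ν(z²)` with `G_ν` entire (`besselG`), and `X = x⁻¹D`. Up to a
constant, the forward transform of `f` is `e^{(i/2)w² cot θ} w^{ν-μ} U_ν φ(c w²)`, where `c = csc²
θ`, `φ` is the chirp of `f` of sign `η = 1`, and `U_l φ(r) = ∫ G_l(rt²) t^{2l+1} φ(t) dt`
(`besselU`). The inverse transform is the same with `η = -1`. Taking the chirp of sign `ε` of the
result cancels the power of `w` and leaves `e^{(i/2)(ε+η)w² cot θ} U_ν φ(c w²)`.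

Three facts about `U_l` carry the estimate. Since `X` is twice differentiation in `x²` and `U_l' =
-U_{l+1}/4`, one has `X^q [U_ν φ(cx²)] = (-c/2)^q U_{ν+q} φ(cx²)`. By `abs_besselG_le`, `|G_{ν+q}| ≤
1/Γ(ν+q+1) ≤ C 2^q/q!` on the half-line. By `mul_besselU`, a factor `r` can be traded for two
applications of `X` to `φ` without changing the order `l`. Hence `q` derivatives of the output cost
only about `2q` powers of `t` on the input, that is `(A+δ)^{2q} (2q)^{2qα} = ((A+δ)² 2^{2α})^q
q^{2qα}`, and `1/q!` absorbs every geometric or polynomial factor in `q`. A fixed power of `x` uses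
only finitely many derivatives of `φ`, so converting the chirp sign on the domain side costs a
constant.

The remaining output chirp is trivial if `ε = -η` or `θ = π/2`. Otherwise its Leibniz sum is
absorbed by the slack `σ`, which needs `q^{2α} → ∞`, hence `α > 0` (`sum_choose_weight_le`). -/

/-- Induction with ratio `q + 1 ≤ 2(q + ν + 1)`, which is where `ν ≥ -1/2` enters. It makes
`1/Γ(q+ν+1)` as small as `2^q/q!`. -/
lemma Gamma_add_nat_lower {ν : ℝ} (hν : -1 / 2 ≤ ν) (q : ℕ) :
    Real.Gamma (ν + 1) * q.factorial ≤ 2 ^ q * Real.Gamma (q + ν + 1) := by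
  induction q with
  | zero => simp
  | succ q ih =>
    have hpos : 0 < (q : ℝ) + ν + 1 := by have : (0 : ℝ) ≤ q := q.cast_nonneg; linarith
    have e : Real.Gamma (((q + 1 : ℕ) : ℝ) + ν + 1) = (q + ν + 1) * Real.Gamma (q + ν + 1) := by
      rw [← Real.Gamma_add_one hpos.ne']; congr 1; push_cast; ring
    rw [e, Nat.factorial_succ, pow_succ]
    push_cast
    have hq : (0 : ℝ) ≤ q := q.cast_nonneg
    have h0 : 0 ≤ 2 ^ q * Real.Gamma (q + ν + 1) := by positivity
    calc Real.Gamma (ν + 1) * ((q + 1) * q.factorial)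
        = (q + 1) * (Real.Gamma (ν + 1) * q.factorial) := by ring
      _ ≤ (q + 1) * (2 ^ q * Real.Gamma (q + ν + 1)) := by gcongr
      _ ≤ (2 * (q + ν + 1)) * (2 ^ q * Real.Gamma (q + ν + 1)) := by
          gcongr; linarith
      _ = _ := by ring

lemma inv_Gamma_add_nat_le {ν : ℝ} (hν : -1 / 2 ≤ ν) (q : ℕ) :
    (Real.Gamma (q + ν + 1))⁻¹ ≤ (Real.Gamma (ν + 1))⁻¹ * (2 ^ q / q.factorial) := by
  have hq : (0 : ℝ) ≤ q := q.cast_nonneg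
  have h1 : 0 < Real.Gamma (ν + 1) := Real.Gamma_pos_of_pos (by linarith)
  have h2 : 0 < Real.Gamma (q + ν + 1) := Real.Gamma_pos_of_pos (by linarith)
  have h3 : (0 : ℝ) < q.factorial := by exact_mod_cast q.factorial_pos
  rw [inv_mul_eq_div, div_div, inv_eq_one_div, div_le_div_iff₀ h2 (by positivity)]
  have := Gamma_add_nat_lower hν q
  linarith

/-- The coefficients of the normalized Bessel function. -/
def besselCoeff (l : ℝ) (m : ℕ) : ℝ := (-1 / 4) ^ m / (m.factorial * Real.Gamma (m + l + 1))

/-- The normalized Bessel function: `J_l(z) = (z / 2) ^ l * besselG l (z ^ 2)`. -/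
def besselG (l s : ℝ) : ℝ := ∑' m : ℕ, besselCoeff l m * s ^ m

lemma abs_besselCoeff_le {l : ℝ} (hl : -1 / 2 ≤ l) (m : ℕ) :
    |besselCoeff l m| ≤ (Real.Gamma (l + 1))⁻¹ * (1 / m.factorial) := by
  have hm : (0 : ℝ) ≤ m := m.cast_nonneg
  have h1 : 0 < Real.Gamma (l + 1) := Real.Gamma_pos_of_pos (by linarith)
  have h2 : 0 < Real.Gamma (m + l + 1) := Real.Gamma_pos_of_pos (by linarith)
  have h3 : (1 : ℝ) ≤ m.factorial := by exact_mod_cast m.factorial_pos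
  have e : |besselCoeff l m| = (1 / 4) ^ m * (1 / m.factorial) * (Real.Gamma (m + l + 1))⁻¹ := by
    rw [besselCoeff, abs_div, abs_pow, abs_mul, abs_of_pos h2,
      abs_of_pos (by linarith : (0 : ℝ) < m.factorial)]
    norm_num [abs_div]
    field_simp
  rw [e]
  calc (1 / 4 : ℝ) ^ m * (1 / m.factorial) * (Real.Gamma (m + l + 1))⁻¹
      ≤ (1 / 4 : ℝ) ^ m * (1 / m.factorial) * ((Real.Gamma (l + 1))⁻¹ * (2 ^ m / m.factorial)) := by
        gcongr; exact inv_Gamma_add_nat_le hl m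
    _ = (1 / 2 : ℝ) ^ m * (1 / m.factorial) * ((Real.Gamma (l + 1))⁻¹ * (1 / m.factorial)) := by
        have : (1 / 4 : ℝ) ^ m * 2 ^ m = (1 / 2) ^ m := by rw [← mul_pow]; norm_num
        rw [← this]; ring
    _ ≤ 1 * 1 * ((Real.Gamma (l + 1))⁻¹ * (1 / m.factorial)) := by
        gcongr
        · exact pow_le_one₀ (by norm_num) (by norm_num)
        · rw [div_le_one (by linarith)]; exact h3
    _ = _ := by ring

lemma summable_besselG {l : ℝ} (hl : -1 / 2 ≤ l) (s : ℝ) :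
    Summable fun m : ℕ => besselCoeff l m * s ^ m := by
  refine Summable.of_norm_bounded
    ((Real.summable_pow_div_factorial |s|).mul_left (Real.Gamma (l + 1))⁻¹) fun m => ?_
  rw [norm_mul, norm_pow, Real.norm_eq_abs, Real.norm_eq_abs]
  refine (mul_le_mul_of_nonneg_right (abs_besselCoeff_le hl m) (by positivity)).trans (le_of_eq ?_)
  ring

lemma besselCoeff_succ (l : ℝ) (m : ℕ) :
    besselCoeff l (m + 1) * (m + 1) = -1 / 4 * besselCoeff (l + 1) m := by
  have h3 : (m.factorial : ℝ) ≠ 0 := by exact_mod_cast m.factorial_ne_zero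
  rw [besselCoeff, besselCoeff, Nat.factorial_succ, pow_succ]
  have : ((m + 1 : ℕ) : ℝ) + l + 1 = m + (l + 1) + 1 := by push_cast; ring
  rw [this]
  push_cast
  have : (m : ℝ) + 1 ≠ 0 := by positivity
  field_simp

lemma hasDerivAt_besselG {l : ℝ} (hl : -1 / 2 ≤ l) (s : ℝ) :
    HasDerivAt (besselG l) (-1 / 4 * besselG (l + 1) s) s := by
  set R := |s| + 1
  have hR : 0 ≤ R := by positivity
  -- The differentiated series is dominated on the ball of radius `R = |s| + 1`; after shifting the
  -- index by one the majorant is an exponential series.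
  have hu : Summable fun m : ℕ => |besselCoeff l m| * (m * R ^ (m - 1)) := by
    rw [← summable_nat_add_iff 1]
    refine Summable.of_nonneg_of_le (fun m => by positivity) (fun m => ?_)
      ((Real.summable_pow_div_factorial R).mul_left (Real.Gamma (l + 1))⁻¹)
    refine (mul_le_mul_of_nonneg_right (abs_besselCoeff_le hl (m + 1))
      (by positivity)).trans (le_of_eq ?_)
    have h3 : (m.factorial : ℝ) ≠ 0 := by exact_mod_cast m.factorial_ne_zero
    rw [Nat.factorial_succ]
    have : (m : ℝ) + 1 ≠ 0 := by positivity
    push_cast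
    field_simp
  have key := hasDerivAt_tsum_of_isPreconnected (t := Metric.ball (0 : ℝ) R)
    (g := fun m : ℕ => fun y : ℝ => besselCoeff l m * y ^ m)
    (g' := fun m : ℕ => fun y : ℝ => besselCoeff l m * (m * y ^ (m - 1))) hu Metric.isOpen_ball
    (convex_ball (0 : ℝ) R).isPreconnected
    (fun m y _ => (hasDerivAt_pow m y).const_mul _)
    (fun m y hy => by
      have hy' : |y| ≤ R := by
        have := Metric.mem_ball.1 hy
        rw [Real.dist_eq, sub_zero] at this; exact this.le
      rw [norm_mul, norm_mul, norm_pow, Real.norm_eq_abs, Real.norm_eq_abs, Real.norm_eq_abs,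
        Nat.abs_cast]
      gcongr)
    (y₀ := s) (y := s) (by simp [R]) (summable_besselG hl s) (by simp [R])
  have e : (∑' m : ℕ, besselCoeff l m * (m * s ^ (m - 1))) = -1 / 4 * besselG (l + 1) s := by
    have hs : Summable fun m : ℕ => besselCoeff l m * (m * s ^ (m - 1)) := by
      refine Summable.of_norm_bounded hu fun m => ?_
      rw [norm_mul, norm_mul, norm_pow, Real.norm_eq_abs, Real.norm_eq_abs, Real.norm_eq_abs,
        Nat.abs_cast]
      gcongr
      simp [R]
    rw [hs.tsum_eq_zero_add, besselG, ← tsum_mul_left]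
    simp only [CharP.cast_eq_zero, zero_mul, mul_zero, zero_add]
    congr 1
    funext m
    rw [← mul_assoc (-1 / 4 : ℝ), ← besselCoeff_succ]
    rw [Nat.add_sub_cancel]
    push_cast
    ring
  rw [e] at key
  exact key

/-- Coefficientwise this is `Γ(x+1) = xΓ(x)`: the `m`-th coefficient of `G_l` is `m + l + 1` times
that of `G_{l+1}`, and the part with factor `m` is `s G_{l+1}' = -(s/4) G_{l+2}`. -/
lemma besselG_recurrence {l : ℝ} (hl : -1 / 2 ≤ l) (s : ℝ) :
    (l + 1) * besselG (l + 1) s - s / 4 * besselG (l + 2) s = besselG l s := by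
  have h1 : HasSum (fun m => besselCoeff (l + 1) m * s ^ m) (besselG (l + 1) s) :=
    (summable_besselG (by linarith) s).hasSum
  have h2 : HasSum (fun m => besselCoeff (l + 2) m * s ^ m) (besselG (l + 2) s) :=
    (summable_besselG (by linarith) s).hasSum
  have h3 : HasSum (fun m : ℕ => m * besselCoeff (l + 1) m * s ^ m)
      (-(s / 4) * besselG (l + 2) s) := by
    rw [← hasSum_nat_add_iff' 1]
    simp only [Finset.range_one, Finset.sum_singleton, CharP.cast_eq_zero, zero_mul, sub_zero]
    refine (h2.mul_left (-(s / 4))).congr_fun fun m => ?_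
    have := besselCoeff_succ (l + 1) m
    rw [show l + 1 + 1 = l + 2 by ring] at this
    push_cast
    linear_combination s ^ (m + 1) * this
  have h4 := (h1.mul_left (l + 1)).add h3
  have h5 : HasSum (fun m => besselCoeff l m * s ^ m) (besselG l s) :=
    (summable_besselG hl s).hasSum
  have e : (fun m : ℕ => besselCoeff l m * s ^ m) = fun m : ℕ =>
      (l + 1) * (besselCoeff (l + 1) m * s ^ m) + m * besselCoeff (l + 1) m * s ^ m := by
    funext m
    have hm : (0 : ℝ) ≤ m := m.cast_nonneg
    have hp : 0 < (m : ℝ) + l + 1 := by linarith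
    have h3 : (m.factorial : ℝ) ≠ 0 := by exact_mod_cast m.factorial_ne_zero
    have hG : Real.Gamma (m + l + 1) ≠ 0 := (Real.Gamma_pos_of_pos hp).ne'
    rw [besselCoeff, besselCoeff, show (m : ℝ) + (l + 1) + 1 = (m + l + 1) + 1 by ring,
      Real.Gamma_add_one hp.ne']
    field_simp
    ring
  rw [e] at h5
  have := h5.unique h4
  linarith

lemma besselG_zero (l : ℝ) : besselG l 0 = (Real.Gamma (l + 1))⁻¹ := by
  rw [besselG, tsum_eq_single 0 (fun m hm => by simp [hm])]
  simp [besselCoeff]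

/-- Energy argument: `G_l² + (s/4) G_{l+1}²` has derivative `-(2l+1)/4 · G_{l+1}²`, so it decreases
when `l ≥ -1/2`. For `s ≥ 0` it dominates `G_l²`, and at `s = 0` it equals `Γ(l+1)⁻²`. -/
lemma abs_besselG_le {l s : ℝ} (hl : -1 / 2 ≤ l) (hs : 0 ≤ s) :
    |besselG l s| ≤ (Real.Gamma (l + 1))⁻¹ := by
  set H : ℝ → ℝ := fun s => besselG l s ^ 2 + s / 4 * besselG (l + 1) s ^ 2
  have hH : ∀ s, HasDerivAt H (-(2 * l + 1) / 4 * besselG (l + 1) s ^ 2) s := by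
    intro s
    have h1 := (hasDerivAt_besselG hl s).pow 2
    have h2 := (hasDerivAt_besselG (l := l + 1) (by linarith) s).pow 2
    have h3 := h1.add (((hasDerivAt_id s).div_const 4).mul h2)
    refine h3.congr_deriv ?_
    have := besselG_recurrence hl s
    rw [show l + 1 + 1 = l + 2 by ring]
    simp only [id, Nat.cast_ofNat, Nat.add_one_sub_one, pow_one, Pi.pow_apply]
    linear_combination (1 / 2 * besselG (l + 1) s) * this
  have hanti : Antitone H := antitone_of_deriv_nonpos (fun s => (hH s).differentiableAt)
    fun s => by
      rw [(hH s).deriv]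
      have : 0 ≤ besselG (l + 1) s ^ 2 := sq_nonneg _
      nlinarith
  have h0 := hanti hs
  have hpos : 0 < Real.Gamma (l + 1) := Real.Gamma_pos_of_pos (by linarith)
  refine abs_le_of_sq_le_sq ?_ (inv_nonneg.2 hpos.le)
  simp only [H, besselG_zero] at h0
  have : 0 ≤ s / 4 * besselG (l + 1) s ^ 2 := by positivity
  linarith

lemma besselJ_eq (ν : ℝ) {z : ℝ} (hz : 0 < z) :
    besselJ ν z = (z / 2) ^ ν * besselG ν (z ^ 2) := by
  rw [besselJ, besselG, ← tsum_mul_left]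
  congr 1
  funext m
  rw [Real.rpow_add (by positivity), besselCoeff,
    show (2 * (m : ℝ)) = ((2 * m : ℕ) : ℝ) by push_cast; ring, Real.rpow_natCast, pow_mul]
  have : (-1 / 4 : ℝ) ^ m = (-1) ^ m * ((1 / 2) ^ 2) ^ m := by rw [← mul_pow]; norm_num
  rw [this, show (z / 2) ^ 2 = (1 / 2) ^ 2 * z ^ 2 by ring, mul_pow]
  ring

lemma continuous_besselG {l : ℝ} (hl : -1 / 2 ≤ l) : Continuous (besselG l) :=
  continuous_iff_continuousAt.2 fun s => (hasDerivAt_besselG hl s).continuousAt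

/-! ### The Hankel-type transform with kernel `besselG` -/

/-- Continuous functions on the half-line decaying faster than every power. -/
def RapidDecay (φ : ℝ → ℂ) : Prop :=
  ContinuousOn φ (Ioi 0) ∧ ∀ k : ℕ, ∃ C : ℝ, ∀ x : ℝ, 0 < x → x ^ k * ‖φ x‖ ≤ C

/-- The transform `∫_0^∞ besselG l (r t²) t^{2l+1} φ(t) dt`. -/
def besselU (l : ℝ) (φ : ℝ → ℂ) (r : ℝ) : ℂ :=
  ∫ t in Ioi (0 : ℝ), ((besselG l (r * t ^ 2) * t ^ (2 * l + 1) : ℝ) : ℂ) * φ t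

/-- Since `x^p ≤ 1 + x^n`, expanding `(1 + x^n)(1 + x²)y` gives four monomials, each at most `C`.
This turns integer-power bounds into an integrable majorant for a real power. -/
lemma rpow_mul_le_of_pow_mul_le {p x y C : ℝ} {n : ℕ} (hp : 0 ≤ p) (hpn : p ≤ n) (hx : 0 < x)
    (hy : 0 ≤ y) (h : ∀ i ≤ n + 2, x ^ i * y ≤ C) : x ^ p * y ≤ 4 * C * (1 + x ^ 2)⁻¹ := by
  have h1 : x ^ p ≤ 1 + x ^ n := by
    rcases le_total x 1 with h1 | h1
    · have := Real.rpow_le_one hx.le h1 hp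
      have : 0 ≤ x ^ n := by positivity
      linarith
    · have := Real.rpow_le_rpow_of_exponent_le h1 hpn
      rw [Real.rpow_natCast] at this
      linarith
  rw [← div_eq_mul_inv, le_div_iff₀ (by positivity)]
  have e0 := h 0 (by omega)
  have e1 := h 2 (by omega)
  have e2 := h n (by omega)
  have e3 := h (n + 2) le_rfl
  calc x ^ p * y * (1 + x ^ 2) ≤ (1 + x ^ n) * y * (1 + x ^ 2) := by gcongr
    _ = x ^ 0 * y + x ^ 2 * y + x ^ n * y + x ^ (n + 2) * y := by ring
    _ ≤ _ := by linarith

lemma RapidDecay.rpow_bound {φ : ℝ → ℂ} (h : RapidDecay φ) {p : ℝ} (hp : 0 ≤ p) :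
    ∃ C : ℝ, 0 ≤ C ∧ ∀ x : ℝ, 0 < x → x ^ p * ‖φ x‖ ≤ C * (1 + x ^ 2)⁻¹ := by
  choose C hC using h.2
  obtain ⟨n, hn⟩ := exists_nat_ge p
  have hC0 : ∀ k, 0 ≤ C k := fun k => by
    have := hC k 1 one_pos
    rw [one_pow, one_mul] at this
    exact (norm_nonneg _).trans this
  refine ⟨4 * ∑ i ∈ Finset.range (n + 3), C i,
    mul_nonneg (by norm_num) (Finset.sum_nonneg fun i _ => hC0 i), fun x hx => ?_⟩
  refine rpow_mul_le_of_pow_mul_le hp hn hx (norm_nonneg _) fun i hi => (hC i x hx).trans ?_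
  exact Finset.single_le_sum (f := C) (fun i _ => hC0 i) (Finset.mem_range.2 (by omega))

lemma continuousOn_rpow_Ioi (p : ℝ) : ContinuousOn (fun t : ℝ => t ^ p) (Ioi 0) :=
  fun x hx => (Real.continuousAt_rpow_const x p (Or.inl (ne_of_gt hx))).continuousWithinAt

lemma aestronglyMeasurable_besselU {l : ℝ} (hl : -1 / 2 ≤ l) (p : ℝ) {φ : ℝ → ℂ}
    (h : ContinuousOn φ (Ioi 0)) (r : ℝ) :
    AEStronglyMeasurable (fun t : ℝ => ((besselG l (r * t ^ 2) * t ^ p : ℝ) : ℂ) * φ t)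
      (volume.restrict (Ioi 0)) := by
  refine ContinuousOn.aestronglyMeasurable ?_ measurableSet_Ioi
  refine (Complex.continuous_ofReal.comp_continuousOn (ContinuousOn.mul ?_
    (continuousOn_rpow_Ioi p))).mul h
  exact ((continuous_besselG hl).comp (by fun_prop)).continuousOn

lemma norm_besselU_integrand_le {l : ℝ} (hl : -1 / 2 ≤ l) {p C r t : ℝ} {z : ℂ} (hr : 0 ≤ r)
    (ht : 0 < t) (h : t ^ p * ‖z‖ ≤ C) :
    ‖((besselG l (r * t ^ 2) * t ^ p : ℝ) : ℂ) * z‖ ≤ (Real.Gamma (l + 1))⁻¹ * C := by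
  have hG : 0 < Real.Gamma (l + 1) := Real.Gamma_pos_of_pos (by linarith)
  rw [norm_mul, Complex.norm_real, norm_mul, Real.norm_eq_abs, Real.norm_eq_abs,
    abs_of_nonneg (Real.rpow_nonneg ht.le _), mul_assoc]
  exact mul_le_mul (abs_besselG_le hl (by positivity)) h (by positivity) (by positivity)

lemma integrableOn_besselU {l : ℝ} (hl : -1 / 2 ≤ l) {p : ℝ} (hp : 0 ≤ p) {φ : ℝ → ℂ}
    (h : RapidDecay φ) {r : ℝ} (hr : 0 ≤ r) :
    IntegrableOn (fun t : ℝ => ((besselG l (r * t ^ 2) * t ^ p : ℝ) : ℂ) * φ t) (Ioi 0) := by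
  obtain ⟨C, -, hC⟩ := h.rpow_bound hp
  refine Integrable.mono' ((integrable_inv_one_add_sq.const_mul C).const_mul
    (Real.Gamma (l + 1))⁻¹).integrableOn (aestronglyMeasurable_besselU hl p h.1 r) ?_
  exact (ae_restrict_mem measurableSet_Ioi).mono fun t ht =>
    norm_besselU_integrand_le hl hr ht (hC t ht)

lemma norm_besselU_le {l : ℝ} (hl : -1 / 2 ≤ l) {φ : ℝ → ℂ} {C r : ℝ} (hr : 0 ≤ r)
    (hC : ∀ x : ℝ, 0 < x → x ^ (2 * l + 1) * ‖φ x‖ ≤ C * (1 + x ^ 2)⁻¹) :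
    ‖besselU l φ r‖ ≤ (Real.Gamma (l + 1))⁻¹ * (C * (Real.pi / 2)) := by
  have hi : IntegrableOn (fun x : ℝ => (Real.Gamma (l + 1))⁻¹ * (C * (1 + x ^ 2)⁻¹)) (Ioi 0) :=
    ((integrable_inv_one_add_sq.const_mul C).const_mul (Real.Gamma (l + 1))⁻¹).integrableOn
  refine (norm_integral_le_of_norm_le hi ((ae_restrict_mem measurableSet_Ioi).mono fun t ht =>
    norm_besselU_integrand_le hl hr ht (hC t ht))).trans (le_of_eq ?_)
  rw [integral_const_mul, integral_const_mul, integral_Ioi_inv_one_add_sq]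
  simp

/-- Differentiation under the integral: the factor `t²` from the chain rule is exactly what raises
`t^{2l+1}` to the power belonging to order `l + 1`. The uniform bound on `G_{l+1}` gives a majorant
independent of `r`. -/
lemma hasDerivAt_besselU {l : ℝ} (hl : -1 / 2 ≤ l) {φ : ℝ → ℂ} (h : RapidDecay φ) {r : ℝ}
    (hr : 0 < r) : HasDerivAt (besselU l φ) (-1 / 4 * besselU (l + 1) φ r) r := by
  have hl1 : -1 / 2 ≤ l + 1 := by linarith
  obtain ⟨C, -, hC⟩ := h.rpow_bound (p := 2 * (l + 1) + 1) (by linarith)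
  have key := hasDerivAt_integral_of_dominated_loc_of_deriv_le (μ := volume.restrict (Ioi 0))
    (F := fun r t => ((besselG l (r * t ^ 2) * t ^ (2 * l + 1) : ℝ) : ℂ) * φ t)
    (F' := fun r t => -1 / 4 *
      (((besselG (l + 1) (r * t ^ 2) * t ^ (2 * (l + 1) + 1) : ℝ) : ℂ) * φ t))
    (x₀ := r) (s := Ioi 0) (bound := fun t => 1 / 4 * ((Real.Gamma (l + 1 + 1))⁻¹ *
      (C * (1 + t ^ 2)⁻¹))) (Ioi_mem_nhds hr)
    (Eventually.of_forall fun r => aestronglyMeasurable_besselU hl _ h.1 r)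
    (integrableOn_besselU hl (by linarith) h hr.le)
    ((aestronglyMeasurable_besselU hl1 _ h.1 r).const_mul _)
    ((ae_restrict_mem measurableSet_Ioi).mono fun t ht r' hr' => by
      rw [norm_mul]
      refine mul_le_mul (le_of_eq (by norm_num)) (norm_besselU_integrand_le hl1
        (le_of_lt hr') ht (hC t ht)) (norm_nonneg _) (by norm_num))
    (((integrable_inv_one_add_sq.const_mul C).const_mul _).const_mul _).integrableOn
    ((ae_restrict_mem measurableSet_Ioi).mono fun t ht r' hr' => by
      have h1 : HasDerivAt (fun r' : ℝ => besselG l (r' * t ^ 2))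
          (-1 / 4 * besselG (l + 1) (r' * t ^ 2) * (t ^ 2)) r' := by
        have := (hasDerivAt_besselG hl (r' * t ^ 2)).comp r'
          ((hasDerivAt_id r').mul_const (t ^ 2))
        refine this.congr_deriv ?_
        simp
      have h2 := ((h1.mul_const (t ^ (2 * l + 1))).ofReal_comp).mul_const (φ t)
      refine h2.congr_deriv ?_
      have e : t ^ (2 * (l + 1) + 1) = t ^ 2 * t ^ (2 * l + 1) := by
        rw [← Real.rpow_natCast t 2, ← Real.rpow_add ht]; congr 1; push_cast; ring
      rw [e]
      push_cast
      ring)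
  have := key.2
  rw [integral_const_mul] at this
  exact this

lemma contDiffOn_besselU {φ : ℝ → ℂ} (h : RapidDecay φ) {l : ℝ} (hl : -1 / 2 ≤ l) :
    ContDiffOn ℝ ∞ (besselU l φ) (Ioi 0) := by
  rw [contDiffOn_infty]
  intro n
  induction n generalizing l with
  | zero =>
    exact contDiffOn_zero.2 fun r hr => (hasDerivAt_besselU hl h hr).continuousAt.continuousWithinAt
  | succ n ih =>
    push_cast
    rw [contDiffOn_succ_iff_deriv_of_isOpen isOpen_Ioi]
    refine ⟨fun r hr => (hasDerivAt_besselU hl h hr).differentiableAt.differentiableWithinAt,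
      by simp, ?_⟩
    exact ((ih (l := l + 1) (by linarith)).const_smul (-1 / 4 : ℂ)).congr
      fun r hr => (hasDerivAt_besselU hl h hr).deriv

lemma RapidDecay.sq_mul {φ : ℝ → ℂ} (h : RapidDecay φ) :
    RapidDecay fun x => (x : ℂ) ^ 2 * φ x := by
  refine ⟨by have := h.1; fun_prop, fun k => ?_⟩
  obtain ⟨C, hC⟩ := h.2 (k + 2)
  refine ⟨C, fun x hx => le_trans (le_of_eq ?_) (hC x hx)⟩
  rw [norm_mul, norm_pow, Complex.norm_real, Real.norm_eq_abs, abs_of_pos hx]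
  ring

/-- Integration by parts, using that `G_{l+1}(rt²) t^{2l+2}` has derivative `2 G_l(rt²) t^{2l+1}` by
the recurrence. The boundary terms vanish because `2l + 2 > 0` at the origin and by rapid decay at
infinity. -/
lemma besselU_eq_xInvD {l : ℝ} (hl : -1 / 2 ≤ l) {φ : ℝ → ℂ} (hd : DifferentiableOn ℝ φ (Ioi 0))
    (h : RapidDecay φ) (h' : RapidDecay (xInvD φ)) {r : ℝ} (hr : 0 ≤ r) :
    besselU l φ r = -1 / 2 * besselU (l + 1) (xInvD φ) r := by
  have hl1 : -1 / 2 ≤ l + 1 := by linarith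
  set u : ℝ → ℂ := fun t => ((besselG (l + 1) (r * t ^ 2) * t ^ (2 * l + 2) : ℝ) : ℂ)
  set u' : ℝ → ℂ := fun t => ((2 * (besselG l (r * t ^ 2) * t ^ (2 * l + 1)) : ℝ) : ℂ)
  have hu : ∀ t ∈ Ioi (0 : ℝ), HasDerivAt u (u' t) t := by
    intro t ht
    have h1 : HasDerivAt (fun t : ℝ => besselG (l + 1) (r * t ^ 2))
        (-1 / 4 * besselG (l + 2) (r * t ^ 2) * (r * (2 * t))) t := by
      have := (hasDerivAt_besselG hl1 (r * t ^ 2)).comp t ((hasDerivAt_pow 2 t).const_mul r)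
      refine this.congr_deriv ?_
      rw [show l + 1 + 1 = l + 2 by ring]
      simp
    have h2 := h1.mul (Real.hasDerivAt_rpow_const (p := 2 * l + 2) (Or.inl (ne_of_gt ht)))
    refine h2.ofReal_comp.congr_deriv ?_
    refine congrArg Complex.ofReal ?_
    have e : t ^ (2 * l + 2) = t * t ^ (2 * l + 1) := by
      rw [← Real.rpow_one_add' (le_of_lt ht) (by linarith)]; congr 1; ring
    rw [e, show 2 * l + 2 - 1 = 2 * l + 1 by ring, ← besselG_recurrence hl]
    ring
  have hv : ∀ t ∈ Ioi (0 : ℝ), HasDerivAt φ (deriv φ t) t := fun t ht =>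
    (hd.differentiableAt (Ioi_mem_nhds ht)).hasDerivAt
  have e1 : ∀ t ∈ Ioi (0 : ℝ), ((besselG (l + 1) (r * t ^ 2) * t ^ (2 * (l + 1) + 1) : ℝ) : ℂ) *
      xInvD φ t = (u * deriv φ) t := by
    intro t ht
    have ht' : (t : ℂ) ≠ 0 := Complex.ofReal_ne_zero.2 (ne_of_gt ht)
    have e : t ^ (2 * (l + 1) + 1) = t * t ^ (2 * l + 2) := by
      rw [← Real.rpow_one_add' (le_of_lt ht) (by linarith)]; congr 1; ring
    simp only [u, xInvD, Pi.mul_apply, e]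
    push_cast
    field_simp
  have e2 : ∀ t ∈ Ioi (0 : ℝ), 2 * (((besselG l (r * t ^ 2) * t ^ (2 * l + 1) : ℝ) : ℂ) * φ t) =
      (u' * φ) t := by
    intro t ht
    simp only [u', Pi.mul_apply]
    push_cast
    ring
  have i1 : IntegrableOn (u * deriv φ) (Ioi 0) :=
    (integrableOn_besselU hl1 (by linarith) h' hr).congr_fun e1 measurableSet_Ioi
  have i2 : IntegrableOn (u' * φ) (Ioi 0) :=
    IntegrableOn.congr_fun ((integrableOn_besselU hl (p := 2 * l + 1)
      (by linarith) h hr).const_mul 2) e2 measurableSet_Ioi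
  obtain ⟨C0, hC00, hC0⟩ := h.rpow_bound (p := 0) le_rfl
  obtain ⟨C2, hC20, hC2⟩ := h.rpow_bound (p := 2 * l + 2) (by linarith)
  have z0 : Tendsto (u * φ) (𝓝[>] 0) (𝓝 0) := by
    have ht : Tendsto (fun t : ℝ => (Real.Gamma (l + 1 + 1))⁻¹ * (t ^ (2 * l + 2) * C0)) (𝓝[>] 0)
        (𝓝 0) := by
      have : ContinuousAt (fun t : ℝ => (Real.Gamma (l + 1 + 1))⁻¹ * (t ^ (2 * l + 2) * C0)) 0 :=
        ((Real.continuousAt_rpow_const 0 (2 * l + 2) (Or.inr (by linarith))).mul_const _).const_mul _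
      have h3 := this.tendsto
      rw [Real.zero_rpow (by linarith), zero_mul, mul_zero] at h3
      exact h3.mono_left nhdsWithin_le_nhds
    refine squeeze_zero_norm' ?_ ht
    filter_upwards [self_mem_nhdsWithin] with t ht
    refine norm_besselU_integrand_le hl1 hr ht ?_
    gcongr
    · exact Real.rpow_nonneg (le_of_lt ht) _
    · have := hC0 t ht
      rw [Real.rpow_zero, one_mul] at this
      refine this.trans (mul_le_of_le_one_right hC00 ?_)
      exact inv_le_one_of_one_le₀ (by nlinarith [sq_nonneg t])
  have z1 : Tendsto (u * φ) atTop (𝓝 0) := by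
    have ht : Tendsto (fun t : ℝ => (Real.Gamma (l + 1 + 1))⁻¹ * (C2 * t⁻¹)) atTop (𝓝 0) := by
      have := ((tendsto_inv_atTop_zero (𝕜 := ℝ)).const_mul C2).const_mul (Real.Gamma (l + 1 + 1))⁻¹
      simpa using this
    refine squeeze_zero_norm' ?_ ht
    filter_upwards [Ioi_mem_atTop 0] with t ht
    have ht : 0 < t := ht
    refine norm_besselU_integrand_le hl1 hr ht ?_
    refine (hC2 t ht).trans ?_
    gcongr
    nlinarith [sq_nonneg (t - 1)]
  have key := integral_Ioi_mul_deriv_eq_deriv_mul hu hv i1 i2 z0 z1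
  have k1 := setIntegral_congr_fun (μ := volume) measurableSet_Ioi e1
  have k2 := setIntegral_congr_fun (μ := volume) measurableSet_Ioi e2
  simp only [Pi.mul_apply] at k1 k2
  rw [← k1, ← k2, integral_const_mul] at key
  rw [besselU, besselU, key]
  ring

/-- Two integrations by parts give `U_l φ = U_{l+2}(X²φ)/4`. The recurrence then spends the factor
`r` to lower the order, and a further integration by parts, read backwards, returns the remaining
`U_{l+1}` term to order `l`. The gain `1/Γ(l+1)` is thus kept. -/
lemma mul_besselU {l : ℝ} (hl : -1 / 2 ≤ l) {φ : ℝ → ℂ} (hd : DifferentiableOn ℝ φ (Ioi 0))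
    (hd' : DifferentiableOn ℝ (xInvD φ) (Ioi 0)) (h : RapidDecay φ) (h' : RapidDecay (xInvD φ))
    (h'' : RapidDecay (xInvD (xInvD φ))) {r : ℝ} (hr : 0 ≤ r) :
    (r : ℂ) * besselU l φ r = -(((2 * l + 2 : ℝ) : ℂ) * besselU l (xInvD φ) r +
      besselU l (fun x => (x : ℂ) ^ 2 * xInvD (xInvD φ) x) r) := by
  have hl1 : -1 / 2 ≤ l + 1 := by linarith
  have hl2 : -1 / 2 ≤ l + 2 := by linarith
  have a1 := besselU_eq_xInvD hl hd h h' hr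
  have a2 := besselU_eq_xInvD hl1 hd' h' h'' hr
  rw [show l + 1 + 1 = l + 2 by ring] at a2
  -- The recurrence at `s = rt²`, multiplied by `4 t^{2l+3}` and integrated against `X²φ`.
  have a3 : (r : ℂ) * besselU (l + 2) (xInvD (xInvD φ)) r =
      4 * (l + 1) * besselU (l + 1) (xInvD (xInvD φ)) r -
      4 * besselU l (fun x => (x : ℂ) ^ 2 * xInvD (xInvD φ) x) r := by
    rw [besselU, besselU, besselU, ← integral_const_mul, ← integral_const_mul,
      ← integral_const_mul, ← integral_sub]
    · refine setIntegral_congr_fun measurableSet_Ioi fun t ht => ?_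
      have ht : 0 < t := ht
      have e1 : t ^ (2 * (l + 1) + 1) = t ^ 2 * t ^ (2 * l + 1) := by
        rw [← Real.rpow_natCast t 2, ← Real.rpow_add ht]; congr 1; push_cast; ring
      have e2 : t ^ (2 * (l + 2) + 1) = t ^ 4 * t ^ (2 * l + 1) := by
        rw [← Real.rpow_natCast t 4, ← Real.rpow_add ht]; congr 1; push_cast; ring
      have := congrArg (Complex.ofReal) (besselG_recurrence hl (r * t ^ 2))
      push_cast at this
      simp only [e1, e2]
      push_cast
      rw [← this]
      ring
    · exact (integrableOn_besselU hl1 (by linarith) h'' hr).const_mul _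
    · exact (integrableOn_besselU hl (by linarith) h''.sq_mul hr).const_mul _
  have a4 := besselU_eq_xInvD hl hd' h' h'' hr
  push_cast
  linear_combination (r : ℂ) * a1 - (r : ℂ) / 2 * a2 + a3 / 4 + (2 * l + 2) * a4

/-! ### Weights -/

lemma weight_eq {c γ : ℝ} (n : ℕ) : weight c γ n = c ^ n * ((n : ℝ) ^ n) ^ γ := by
  rw [weight, ← Real.rpow_natCast (n : ℝ) n, ← Real.rpow_mul n.cast_nonneg]

lemma weight_pos {c : ℝ} (hc : 0 < c) (γ : ℝ) (n : ℕ) : 0 < weight c γ n := by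
  rw [weight_eq]
  have : (0 : ℝ) < (n : ℝ) ^ n := by exact_mod_cast Nat.pow_self_pos
  positivity

lemma add_pow_self_le (n i : ℕ) :
    ((n + i : ℕ) : ℝ) ^ (n + i) ≤ (n : ℝ) ^ n * (Real.exp i * ((n + i : ℕ) : ℝ) ^ i) := by
  rw [pow_add, ← mul_assoc]
  refine mul_le_mul_of_nonneg_right ?_ (by positivity)
  rcases Nat.eq_zero_or_pos n with rfl | hn
  · simp
  have hn' : (0 : ℝ) < n := by exact_mod_cast hn
  calc ((n + i : ℕ) : ℝ) ^ n = (n * ((i : ℝ) / n + 1)) ^ n := by push_cast; field_simp; ring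
    _ = (n : ℝ) ^ n * ((i : ℝ) / n + 1) ^ n := mul_pow _ _ _
    _ ≤ (n : ℝ) ^ n * (Real.exp ((i : ℝ) / n)) ^ n := by
        gcongr; exact Real.add_one_le_exp _
    _ = _ := by rw [← Real.exp_nat_mul]; congr 2; field_simp

/-- The main factor `a^{2q} (2q)^{2qα}` is the weight with base `a² 2^{2α}` and exponent `2α`. The
shift by `i` costs only `(2q+i)^{iα}` up to a constant; this is `O(e^{2q})` and disappears, together
with `R^q`, into `1/q!`. -/
lemma weight_two_mul_add_le {a α B R : ℝ} (ha : 0 < a) (hα : 0 ≤ α)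
    (hB : a ^ 2 * 2 ^ (2 * α) ≤ B) (hR : 0 ≤ R) (i : ℕ) :
    ∃ K : ℝ, 0 ≤ K ∧ ∀ q : ℕ,
      weight a α (2 * q + i) * (R ^ q / q.factorial) ≤ K * weight B (2 * α) q := by
  obtain ⟨N, hN⟩ := exists_nat_ge α
  set F : ℝ := ((i * N).factorial : ℝ)
  refine ⟨a ^ i * Real.exp i ^ α * (F * Real.exp (1 + i)) * Real.exp (Real.exp 2 * R),
    by positivity, fun q => ?_⟩
  have h1 : (((2 * q + i : ℕ) : ℝ) ^ (2 * q + i)) ^ α ≤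
      (((2 * q : ℕ) : ℝ) ^ (2 * q)) ^ α * (Real.exp i ^ α * (((2 * q + i : ℕ) : ℝ) ^ i) ^ α) := by
    rw [← Real.mul_rpow (by positivity) (by positivity),
      ← Real.mul_rpow (by positivity) (by positivity)]
    exact Real.rpow_le_rpow (by positivity) (add_pow_self_le _ _) hα
  have h2 : (((2 * q + i : ℕ) : ℝ) ^ i) ^ α ≤ F * Real.exp (1 + i) * Real.exp 2 ^ q := by
    set x : ℝ := 1 + ((2 * q + i : ℕ) : ℝ) with hx
    have hx1 : 1 ≤ x := le_add_of_nonneg_right (Nat.cast_nonneg _)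
    calc (((2 * q + i : ℕ) : ℝ) ^ i) ^ α ≤ (x ^ i) ^ α := by
          refine Real.rpow_le_rpow (by positivity) ?_ hα
          gcongr
          linarith
      _ ≤ (x ^ i) ^ (N : ℝ) := Real.rpow_le_rpow_of_exponent_le (one_le_pow₀ hx1) hN
      _ = x ^ (i * N) := by rw [Real.rpow_natCast, pow_mul]
      _ ≤ F * Real.exp x := by
          have := Real.pow_div_factorial_le_exp x (by linarith) (i * N)
          rw [div_le_iff₀ (by positivity)] at this
          linarith
      _ = _ := by
          rw [mul_assoc, ← Real.exp_nat_mul, ← Real.exp_add, hx]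
          congr 2
          push_cast
          ring
  have h3 : a ^ (2 * q) * (((2 * q : ℕ) : ℝ) ^ (2 * q)) ^ α ≤ weight B (2 * α) q := by
    have e : a ^ (2 * q) * (((2 * q : ℕ) : ℝ) ^ (2 * q)) ^ α =
        weight (a ^ 2 * 2 ^ (2 * α)) (2 * α) q := by
      have e1 : (((2 * q : ℕ) : ℝ) ^ (2 * q)) ^ α = (2 ^ (2 * α)) ^ q * ((q : ℝ) ^ q) ^ (2 * α) := by
        rw [← Real.rpow_natCast, ← Real.rpow_natCast, ← Real.rpow_natCast,
          ← Real.rpow_mul (by positivity), ← Real.rpow_mul (by positivity),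
          ← Real.rpow_mul (by positivity)]
        push_cast
        rw [Real.mul_rpow (by positivity) (by positivity)]
        ring_nf
      rw [weight_eq, e1, mul_pow, pow_mul]
      ring
    rw [e, weight_eq, weight_eq]
    gcongr
  have h4 : Real.exp 2 ^ q * (R ^ q / q.factorial) ≤ Real.exp (Real.exp 2 * R) := by
    rw [← mul_div_assoc, ← mul_pow]
    exact Real.pow_div_factorial_le_exp _ (by positivity) q
  have hB0 : 0 < B := lt_of_lt_of_le (by positivity) hB
  calc weight a α (2 * q + i) * (R ^ q / q.factorial)
      ≤ (a ^ (2 * q + i) * ((((2 * q : ℕ) : ℝ) ^ (2 * q)) ^ α * (Real.exp i ^ α *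
        (F * Real.exp (1 + i) * Real.exp 2 ^ q)))) * (R ^ q / q.factorial) := by
        rw [weight_eq]
        gcongr
        refine h1.trans ?_
        gcongr
    _ = a ^ i * Real.exp i ^ α * (F * Real.exp (1 + i)) *
        (Real.exp 2 ^ q * (R ^ q / q.factorial)) *
        (a ^ (2 * q) * (((2 * q : ℕ) : ℝ) ^ (2 * q)) ^ α) := by ring
    _ ≤ _ := by
        gcongr

/-- The sum of the weights at `k, …, k + I`. -/
def weightSum (a α : ℝ) (I k : ℕ) : ℝ := ∑ i ∈ Finset.range (I + 1), weight a α (k + i)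

lemma weightSum_nonneg {a : ℝ} (ha : 0 < a) (α : ℝ) (I k : ℕ) : 0 ≤ weightSum a α I k :=
  Finset.sum_nonneg fun _ _ => (weight_pos ha _ _).le

lemma weightSum_le_add_two {a : ℝ} (ha : 0 < a) (α : ℝ) (I k : ℕ) :
    weightSum a α I k ≤ weightSum a α (I + 2) k :=
  Finset.sum_le_sum_of_subset_of_nonneg (Finset.range_subset_range.2 (by omega))
    fun _ _ _ => (weight_pos ha _ _).le

/-- The window of indices `k+2, …, k+2+I` lies in `k, …, k+I+2`. Windows are summed because a single
weight need not be monotone in its index when the base is small. -/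
lemma weightSum_shift_le {a : ℝ} (ha : 0 < a) (α : ℝ) (I k : ℕ) :
    weightSum a α I (k + 2) ≤ weightSum a α (I + 2) k := by
  have h2 : weightSum a α (I + 2) k = ∑ i ∈ Finset.range (I + 1), weight a α (k + (i + 1 + 1)) +
      weight a α (k + (0 + 1)) + weight a α (k + 0) := by
    rw [weightSum, Finset.sum_range_succ', Finset.sum_range_succ']
  rw [h2, weightSum]
  have h0 := (weight_pos ha α (k + 0)).le
  have h1 := (weight_pos ha α (k + (0 + 1))).le
  have e : ∑ i ∈ Finset.range (I + 1), weight a α (k + (i + 1 + 1)) =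
      ∑ i ∈ Finset.range (I + 1), weight a α (k + 2 + i) :=
    Finset.sum_congr rfl fun i _ => by rw [show k + (i + 1 + 1) = k + 2 + i by ring]
  linarith

lemma weightSum_zero (a α : ℝ) (k : ℕ) : weightSum a α 0 k = weight a α k := by
  simp [weightSum]

lemma weightSum_two_mul_add_le {a α B R : ℝ} (ha : 0 < a) (hα : 0 ≤ α)
    (hB : a ^ 2 * 2 ^ (2 * α) ≤ B) (hR : 0 ≤ R) (I n : ℕ) :
    ∃ K : ℝ, 0 ≤ K ∧ ∀ q : ℕ, (∑ j ∈ Finset.range n, weightSum a α I (2 * q + j)) *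
      (R ^ q / q.factorial) ≤ K * weight B (2 * α) q := by
  choose K hK0 hK using weight_two_mul_add_le ha hα hB hR
  refine ⟨∑ j ∈ Finset.range n, ∑ i ∈ Finset.range (I + 1), K (j + i),
    Finset.sum_nonneg fun _ _ => Finset.sum_nonneg fun _ _ => hK0 _, fun q => ?_⟩
  simp only [weightSum, Finset.sum_mul]
  refine Finset.sum_le_sum fun j _ => Finset.sum_le_sum fun i _ => ?_
  rw [add_assoc]
  exact hK _ _

/-- For `j ≤ q` the weight at `j` is at most `(b q^γ)^j`, and `R ≤ σ q^γ` once `q` is large because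
`γ > 0`. The binomial theorem then sums everything to `((b+σ) q^γ)^q`; the finitely many small `q`
go into the constant. -/
lemma sum_choose_weight_le {b γ σ R : ℝ} (hb : 0 < b) (hγ : 0 < γ) (hσ : 0 < σ) (hR : 0 ≤ R) :
    ∃ K : ℝ, 0 ≤ K ∧ ∀ q : ℕ, ∑ j ∈ Finset.range (q + 1), (q.choose j : ℝ) *
      (R ^ (q - j) * weight b γ j) ≤ K * weight (b + σ) γ q := by
  have hbs : 0 < b + σ := by linarith
  set L : ℕ → ℝ := fun q => ∑ j ∈ Finset.range (q + 1), (q.choose j : ℝ) *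
      (R ^ (q - j) * weight b γ j) with hL
  have hL0 : ∀ q, 0 ≤ L q := fun q => Finset.sum_nonneg fun j _ => by
    have := weight_pos hb γ j
    positivity
  have hev : ∀ᶠ q : ℕ in atTop, R ≤ σ * (q : ℝ) ^ γ :=
    (((tendsto_rpow_atTop hγ).comp tendsto_natCast_atTop_atTop).const_mul_atTop
      hσ).eventually_ge_atTop R
  obtain ⟨q₀, hq₀⟩ := eventually_atTop.1 hev
  refine ⟨1 + ∑ q ∈ Finset.range q₀, L q / weight (b + σ) γ q,
    add_nonneg zero_le_one (Finset.sum_nonneg fun q _ =>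
      div_nonneg (hL0 q) (weight_pos hbs γ q).le), fun q => ?_⟩
  have hS : ∀ n ∈ Finset.range q₀, 0 ≤ L n / weight (b + σ) γ n := fun n _ =>
    div_nonneg (hL0 n) (weight_pos hbs γ n).le
  change L q ≤ _
  rw [← div_le_iff₀ (weight_pos hbs γ q)]
  rcases lt_or_ge q q₀ with h | h
  · exact (Finset.single_le_sum (f := fun n => L n / weight (b + σ) γ n) hS
      (Finset.mem_range.2 h)).trans (le_add_of_nonneg_left zero_le_one)
  · refine le_trans ?_ (le_add_of_nonneg_right (Finset.sum_nonneg hS))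
    rw [div_le_one (weight_pos hbs γ q)]
    have e : weight (b + σ) γ q = ∑ j ∈ Finset.range (q + 1), (q.choose j : ℝ) *
        ((σ * (q : ℝ) ^ γ) ^ (q - j) * (b * (q : ℝ) ^ γ) ^ j) := by
      have : weight (b + σ) γ q = (b * (q : ℝ) ^ γ + σ * (q : ℝ) ^ γ) ^ q := by
        rw [← add_mul, mul_pow, weight, ← Real.rpow_natCast ((q : ℝ) ^ γ),
          ← Real.rpow_mul q.cast_nonneg, mul_comm γ]
      rw [this, add_pow]
      exact Finset.sum_congr rfl fun j _ => by ring
    rw [e]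
    refine Finset.sum_le_sum fun j hj => ?_
    have hj : j ≤ q := Nat.lt_succ_iff.1 (Finset.mem_range.1 hj)
    have h1 : weight b γ j ≤ (b * (q : ℝ) ^ γ) ^ j := by
      rw [weight, mul_pow, ← Real.rpow_natCast ((q : ℝ) ^ γ), ← Real.rpow_mul q.cast_nonneg,
        mul_comm γ]
      gcongr
    have h2 := hq₀ q h
    have := weight_pos hb γ j
    gcongr

/-! ### Iterates of `x⁻¹ D` -/

lemma xInvD_congr {g h : ℝ → ℂ} (e : EqOn g h (Ioi 0)) : EqOn (xInvD g) (xInvD h) (Ioi 0) := by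
  intro x hx
  rw [xInvD, xInvD, (eventuallyEq_of_mem (Ioi_mem_nhds hx) e).deriv_eq]

lemma iter_xInvD_congr {g h : ℝ → ℂ} (e : EqOn g h (Ioi 0)) (q : ℕ) :
    EqOn (xInvD^[q] g) (xInvD^[q] h) (Ioi 0) := by
  induction q with
  | zero => exact e
  | succ q ih => simp only [Function.iterate_succ_apply']; exact xInvD_congr ih

lemma differentiableAt_of_contDiffOn_Ioi {g : ℝ → ℂ} (hg : ContDiffOn ℝ ∞ g (Ioi 0)) {x : ℝ}
    (hx : 0 < x) : DifferentiableAt ℝ g x :=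
  (hg.contDiffAt (Ioi_mem_nhds hx)).differentiableAt (by simp)

lemma contDiffOn_sq_mul {φ : ℝ → ℂ} (h : ContDiffOn ℝ ∞ φ (Ioi 0)) :
    ContDiffOn ℝ ∞ (fun x : ℝ => (x : ℂ) ^ 2 * φ x) (Ioi 0) :=
  (Complex.ofRealCLM.contDiff.contDiffOn.pow 2).mul h

lemma xInvD_sq_mul {φ : ℝ → ℂ} (h : ContDiffOn ℝ ∞ φ (Ioi 0)) :
    EqOn (xInvD fun x => (x : ℂ) ^ 2 * φ x)
      ((fun x : ℝ => (x : ℂ) ^ 2 * xInvD φ x) + (2 : ℂ) • φ) (Ioi 0) := by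
  intro x hx
  have hx' : (x : ℂ) ≠ 0 := Complex.ofReal_ne_zero.2 (ne_of_gt hx)
  have h1 : HasDerivAt (fun x : ℝ => (x : ℂ) ^ 2) (2 * x) x := by
    refine ((Complex.ofRealCLM.hasDerivAt (x := x)).pow 2).congr_deriv ?_
    simp
  have := (h1.mul (differentiableAt_of_contDiffOn_Ioi h hx).hasDerivAt).deriv
  simp only [xInvD, Pi.add_apply, Pi.smul_apply, smul_eq_mul]
  erw [this]
  field_simp
  ring

/-- In the variable `x²` the multiplier is linear, so the Leibniz expansion stops after two terms.
At `j = 0` the truncated index `j - 1` is harmless, its coefficient being zero. -/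
lemma iter_xInvD_sq_mul {φ : ℝ → ℂ} (h : ContDiffOn ℝ ∞ φ (Ioi 0)) (j : ℕ) :
    EqOn (xInvD^[j] fun x => (x : ℂ) ^ 2 * φ x)
      (fun x => (x : ℂ) ^ 2 * xInvD^[j] φ x + 2 * j * xInvD^[j - 1] φ x) (Ioi 0) := by
  induction j generalizing φ with
  | zero => intro x _; simp
  | succ j ih =>
    intro x hx
    have h2 : ContDiffOn ℝ ∞ ((2 : ℂ) • φ) (Ioi 0) := h.const_smul (2 : ℂ)
    rw [Function.iterate_succ_apply, iter_xInvD_congr (xInvD_sq_mul h) j hx,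
      iter_xInvD_add (contDiffOn_sq_mul (xInvD_smooth h)) h2 j hx,
      iter_xInvD_smul]
    simp only [Pi.add_apply, Pi.smul_apply, smul_eq_mul]
    rw [ih (xInvD_smooth h) hx]
    rcases j with _ | j
    · simp
    · simp only [Nat.add_sub_cancel, ← Function.iterate_succ_apply]
      push_cast
      ring

/-- The chirp `e^{iκx²}`. -/
def cexpSq (κ x : ℝ) : ℂ := Complex.exp (Complex.I * ((κ * x ^ 2 : ℝ) : ℂ))

lemma norm_cexpSq (κ x : ℝ) : ‖cexpSq κ x‖ = 1 := by
  rw [cexpSq, mul_comm, Complex.norm_exp_ofReal_mul_I]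

lemma contDiff_cexpSq (κ : ℝ) : ContDiff ℝ ∞ (cexpSq κ) :=
  ContDiff.cexp (contDiff_const.mul (Complex.ofRealCLM.contDiff.comp
    (contDiff_const.mul (contDiff_id.pow 2))))

lemma xInvD_cexpSq_mul (κ : ℝ) {g : ℝ → ℂ} (h : ContDiffOn ℝ ∞ g (Ioi 0)) :
    EqOn (xInvD fun x => cexpSq κ x * g x)
      ((2 * Complex.I * κ) • (fun x : ℝ => cexpSq κ x * g x) +
        fun x : ℝ => cexpSq κ x * xInvD g x) (Ioi 0) := by
  intro x hx
  have hx' : (x : ℂ) ≠ 0 := Complex.ofReal_ne_zero.2 (ne_of_gt hx)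
  have h1 : HasDerivAt (cexpSq κ) (cexpSq κ x * (Complex.I * (2 * κ * x))) x := by
    have := (((hasDerivAt_pow 2 x).const_mul κ).ofReal_comp.const_mul Complex.I).cexp
    refine this.congr_deriv ?_
    rw [cexpSq]
    push_cast
    ring
  have := (h1.mul (differentiableAt_of_contDiffOn_Ioi h hx).hasDerivAt).deriv
  simp only [xInvD, Pi.add_apply, Pi.smul_apply, smul_eq_mul]
  erw [this]
  field_simp

lemma contDiffOn_cexpSq_mul (κ : ℝ) {g : ℝ → ℂ} (h : ContDiffOn ℝ ∞ g (Ioi 0)) :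
    ContDiffOn ℝ ∞ (fun x : ℝ => cexpSq κ x * g x) (Ioi 0) :=
  (contDiff_cexpSq κ).contDiffOn.mul h

/-- The chirp is a unimodular eigenfunction of `X` with eigenvalue `2iκ`, so `X^q` acts on the
product as `(2iκ + X)^q` acts on `g`. -/
lemma norm_iter_xInvD_cexpSq_mul_le (κ : ℝ) {g : ℝ → ℂ} (h : ContDiffOn ℝ ∞ g (Ioi 0)) (q : ℕ)
    {x : ℝ} (hx : 0 < x) :
    ‖(xInvD^[q] fun x => cexpSq κ x * g x) x‖ ≤ ∑ j ∈ Finset.range (q + 1), (q.choose j : ℝ) *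
      ((2 * |κ|) ^ (q - j) * ‖xInvD^[j] g x‖) := by
  induction q generalizing g with
  | zero => simp [norm_cexpSq]
  | succ q ih =>
    have h2 : ContDiffOn ℝ ∞ ((2 * Complex.I * κ) • fun x : ℝ => cexpSq κ x * g x) (Ioi 0) :=
      (contDiffOn_cexpSq_mul κ h).const_smul (2 * Complex.I * κ)
    rw [Function.iterate_succ_apply, iter_xInvD_congr (xInvD_cexpSq_mul κ h) q hx,
      iter_xInvD_add h2
        (contDiffOn_cexpSq_mul κ (xInvD_smooth h)) q hx, iter_xInvD_smul]
    simp only [Pi.add_apply, Pi.smul_apply]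
    refine (norm_add_le _ _).trans ?_
    have e := Finset.sum_choose_succ_mul
      (fun j k => (2 * |κ|) ^ k * ‖xInvD^[j] g x‖) q
    rw [e]
    refine add_le_add ?_ (ih (xInvD_smooth h))
    rw [norm_smul]
    have e2 : ‖(2 * Complex.I * κ : ℂ)‖ = 2 * |κ| := by simp
    rw [e2]
    refine (mul_le_mul_of_nonneg_left (ih h) (by positivity)).trans (le_of_eq ?_)
    rw [Finset.mul_sum]
    refine Finset.sum_congr rfl fun j hj => ?_
    have hj : j ≤ q := Nat.lt_succ_iff.1 (Finset.mem_range.1 hj)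
    rw [show q + 1 - j = q - j + 1 by omega, pow_succ]
    ring

/-- The first `N` iterates of `x⁻¹ D` on `φ` are bounded by `M * w k * x ^ (-k)` for every `k`. -/
def SeqBound (w : ℕ → ℝ) (N : ℕ) (M : ℝ) (φ : ℝ → ℂ) : Prop :=
  ∀ j ≤ N, ∀ (k : ℕ) (x : ℝ), 0 < x → x ^ k * ‖xInvD^[j] φ x‖ ≤ M * w k

lemma SeqBound.mono {w : ℕ → ℝ} {N N' : ℕ} {M : ℝ} {φ : ℝ → ℂ} (h : SeqBound w N M φ)
    (hN : N' ≤ N) : SeqBound w N' M φ := fun j hj => h j (hj.trans hN)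

lemma SeqBound.map_xInvD {w : ℕ → ℝ} {N : ℕ} {M : ℝ} {φ : ℝ → ℂ} (h : SeqBound w (N + 1) M φ) :
    SeqBound w N M (xInvD φ) := fun j hj => h (j + 1) (by omega)

lemma SeqBound.rapidDecay {w : ℕ → ℝ} {N : ℕ} {M : ℝ} {φ : ℝ → ℂ} (h : SeqBound w N M φ)
    (hφ : ContDiffOn ℝ ∞ φ (Ioi 0)) : RapidDecay φ :=
  ⟨hφ.continuousOn, fun k => ⟨M * w k, h 0 (Nat.zero_le _) k⟩⟩

lemma SeqBound.sq_mul {a α : ℝ} (ha : 0 < a) {I N : ℕ} {M : ℝ} (hM : 0 ≤ M) {φ : ℝ → ℂ}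
    (h : SeqBound (weightSum a α I) N M φ) (hφ : ContDiffOn ℝ ∞ φ (Ioi 0)) :
    SeqBound (weightSum a α (I + 2)) N ((1 + 2 * N) * M) fun x => (x : ℂ) ^ 2 * φ x := by
  intro j hj k x hx
  rw [iter_xInvD_sq_mul hφ j hx]
  have h1 : ‖(x : ℂ) ^ 2 * xInvD^[j] φ x +
      2 * j * xInvD^[j - 1] φ x‖ ≤
      x ^ 2 * ‖xInvD^[j] φ x‖ + 2 * j * ‖xInvD^[j - 1] φ x‖ := by
    refine (norm_add_le _ _).trans (le_of_eq ?_)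
    simp [abs_of_pos hx]
  have h2 := h j hj (k + 2) x hx
  have h3 := h (j - 1) (by omega) k x hx
  have h4 := mul_le_mul_of_nonneg_left (weightSum_shift_le ha α I k) hM
  have h5 := mul_le_mul_of_nonneg_left (weightSum_le_add_two ha α I k) hM
  have h6 : 0 ≤ M * weightSum a α (I + 2) k := mul_nonneg hM (weightSum_nonneg ha _ _ _)
  have hj' : (j : ℝ) ≤ N := by exact_mod_cast hj
  calc x ^ k * ‖(x : ℂ) ^ 2 * xInvD^[j] φ x + 2 * j * xInvD^[j - 1] φ x‖
      ≤ x ^ k * (x ^ 2 * ‖xInvD^[j] φ x‖ +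
        2 * j * ‖xInvD^[j - 1] φ x‖) := by gcongr
    _ = x ^ (k + 2) * ‖xInvD^[j] φ x‖ +
        2 * j * (x ^ k * ‖xInvD^[j - 1] φ x‖) := by ring
    _ ≤ M * weightSum a α (I + 2) k + 2 * N * (M * weightSum a α (I + 2) k) := by
        refine add_le_add (h2.trans h4) (mul_le_mul (by linarith) (h3.trans h5) (by positivity)
          (by positivity))
    _ = _ := by ring

lemma SeqBound.cexpSq_mul {w : ℕ → ℝ} (hw : ∀ k, 0 ≤ w k) {N : ℕ} {M : ℝ} (hM : 0 ≤ M) {φ : ℝ → ℂ}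
    (h : SeqBound w N M φ) (hφ : ContDiffOn ℝ ∞ φ (Ioi 0)) (κ : ℝ) :
    SeqBound w N ((1 + 2 * |κ|) ^ N * M) fun x => cexpSq κ x * φ x := by
  intro j hj k x hx
  have hMw := mul_nonneg hM (hw k)
  calc x ^ k * ‖(xInvD^[j] fun x => cexpSq κ x * φ x) x‖
      ≤ x ^ k * ∑ i ∈ Finset.range (j + 1), (j.choose i : ℝ) *
        ((2 * |κ|) ^ (j - i) * ‖xInvD^[i] φ x‖) := by
        gcongr; exact norm_iter_xInvD_cexpSq_mul_le κ hφ j hx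
    _ = ∑ i ∈ Finset.range (j + 1), (j.choose i : ℝ) *
        (2 * |κ|) ^ (j - i) * (x ^ k * ‖xInvD^[i] φ x‖) := by
        rw [Finset.mul_sum]; exact Finset.sum_congr rfl fun i _ => by ring
    _ ≤ ∑ i ∈ Finset.range (j + 1), (j.choose i : ℝ) * (2 * |κ|) ^ (j - i) * (M * w k) := by
        refine Finset.sum_le_sum fun i hi => ?_
        have hi : i ≤ j := Nat.lt_succ_iff.1 (Finset.mem_range.1 hi)
        exact mul_le_mul_of_nonneg_left (h i (hi.trans hj) k x hx) (by positivity)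
    _ = (1 + 2 * |κ|) ^ j * (M * w k) := by
        rw [add_pow, Finset.sum_mul]
        exact Finset.sum_congr rfl fun i _ => by rw [one_pow]; ring
    _ ≤ (1 + 2 * |κ|) ^ N * (M * w k) := by
        gcongr
        linarith [abs_nonneg κ]
    _ = _ := by ring

/-! ### The main estimate -/

/-- The kernel power `t^{2(ν+q)+1}` uses the decay of `φ` at integer exponents from `2q` to `2q + n
+ 2`, with `n ≥ 2ν + 1`. The arbitrary `R^q` is affordable because of `1/q!`, and it leaves room for
later losses geometric in `q`. -/
lemma norm_besselU_le_weight {ν a α B R : ℝ} (hν : -1 / 2 ≤ ν) (ha : 0 < a) (hα : 0 ≤ α)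
    (hB : a ^ 2 * 2 ^ (2 * α) ≤ B) (hR : 0 ≤ R) (I : ℕ) :
    ∃ K : ℝ, 0 ≤ K ∧ ∀ (φ : ℝ → ℂ) (M : ℝ), 0 ≤ M → SeqBound (weightSum a α I) 0 M φ →
      ∀ (q : ℕ) (r : ℝ), 0 ≤ r →
        R ^ q * ‖besselU (ν + q) φ r‖ ≤ K * M * weight B (2 * α) q := by
  obtain ⟨n, hn⟩ := exists_nat_ge (2 * ν + 1)
  obtain ⟨K, hK0, hK⟩ := weightSum_two_mul_add_le ha hα hB (R := 2 * R) (by positivity) I (n + 3)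
  have hG : 0 < Real.Gamma (ν + 1) := Real.Gamma_pos_of_pos (by linarith)
  refine ⟨(Real.Gamma (ν + 1))⁻¹ * (4 * (Real.pi / 2)) * K, by positivity,
    fun φ M hM h q r hr => ?_⟩
  set W := ∑ j ∈ Finset.range (n + 3), weightSum a α I (2 * q + j) with hW
  have hW0 : 0 ≤ W := Finset.sum_nonneg fun _ _ => weightSum_nonneg ha _ _ _
  have hq : (0 : ℝ) ≤ q := q.cast_nonneg
  have h1 : ∀ x : ℝ, 0 < x → x ^ (2 * (ν + q) + 1) * ‖φ x‖ ≤ 4 * (M * W) * (1 + x ^ 2)⁻¹ := by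
    intro x hx
    have e : x ^ (2 * (ν + q) + 1) * ‖φ x‖ = x ^ (2 * ν + 1) * (x ^ (2 * q) * ‖φ x‖) := by
      rw [← mul_assoc, ← Real.rpow_natCast x (2 * q), ← Real.rpow_add hx]
      congr 2; push_cast; ring
    rw [e]
    refine rpow_mul_le_of_pow_mul_le (by linarith) hn hx (by positivity) fun i hi => ?_
    rw [← mul_assoc, ← pow_add, add_comm]
    refine (h 0 le_rfl _ x hx).trans (mul_le_mul_of_nonneg_left ?_ hM)
    exact Finset.single_le_sum (f := fun j => weightSum a α I (2 * q + j))
      (fun _ _ => weightSum_nonneg ha _ _ _) (Finset.mem_range.2 (by omega))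
  have h2 := norm_besselU_le (by linarith) hr h1
  rw [show ν + q + 1 = q + ν + 1 by ring] at h2
  calc R ^ q * ‖besselU (ν + q) φ r‖
      ≤ R ^ q * (((Real.Gamma (ν + 1))⁻¹ * (2 ^ q / q.factorial)) *
        (4 * (M * W) * (Real.pi / 2))) := by
        gcongr
        exact h2.trans (mul_le_mul_of_nonneg_right (inv_Gamma_add_nat_le hν q) (by positivity))
    _ = (Real.Gamma (ν + 1))⁻¹ * (4 * (Real.pi / 2)) * M *
        (W * ((2 * R) ^ q / q.factorial)) := by rw [mul_pow]; ring
    _ ≤ (Real.Gamma (ν + 1))⁻¹ * (4 * (Real.pi / 2)) * M * (K * weight B (2 * α) q) := by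
        exact mul_le_mul_of_nonneg_left (hK q) (by positivity)
    _ = _ := by ring

/-- Induction on `m` through `mul_besselU`: each factor `r` uses two applications of `X`. `R` and
`I` must vary, since the coefficient `2(ν+q) + 2` is paid for by doubling `R`, and multiplication by
`x²` widens the window by two. -/
lemma pow_mul_norm_besselU_le_weight {ν a α B : ℝ} (hν : -1 / 2 ≤ ν) (ha : 0 < a) (hα : 0 ≤ α)
    (hB : a ^ 2 * 2 ^ (2 * α) ≤ B) (m I : ℕ) {R : ℝ} (hR : 0 ≤ R) :
    ∃ K : ℝ, 0 ≤ K ∧ ∀ (φ : ℝ → ℂ) (M : ℝ), 0 ≤ M → ContDiffOn ℝ ∞ φ (Ioi 0) →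
      SeqBound (weightSum a α I) (2 * m) M φ → ∀ (q : ℕ) (r : ℝ), 0 ≤ r →
        r ^ m * (R ^ q * ‖besselU (ν + q) φ r‖) ≤ K * M * weight B (2 * α) q := by
  induction m generalizing I R with
  | zero =>
    obtain ⟨K, hK0, hK⟩ := norm_besselU_le_weight hν ha hα hB hR I
    refine ⟨K, hK0, fun φ M hM _ h q r hr => ?_⟩
    rw [pow_zero, one_mul]
    exact hK φ M hM h q r hr
  | succ m ih =>
    obtain ⟨K₁, hK₁, h₁⟩ := ih I (R := 2 * R) (by positivity)
    obtain ⟨K₂, hK₂, h₂⟩ := ih (I + 2) hR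
    set c : ℝ := 2 * |ν| + 2 + 2
    refine ⟨c * K₁ + K₂ * (1 + 2 * (2 * m : ℕ)), by positivity, fun φ M hM hφ h q r hr => ?_⟩
    have hs1 := xInvD_smooth hφ
    have hs2 := xInvD_smooth hs1
    have hb1 : SeqBound (weightSum a α I) (2 * m + 1) M (xInvD φ) := h.map_xInvD
    have hb2 := hb1.map_xInvD
    have hq : (0 : ℝ) ≤ q := q.cast_nonneg
    have hdiff : ∀ {g : ℝ → ℂ}, ContDiffOn ℝ ∞ g (Ioi 0) → DifferentiableOn ℝ g (Ioi 0) :=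
      fun hg => hg.differentiableOn (by simp)
    have key := mul_besselU (l := ν + q) (by linarith) (hdiff hφ) (hdiff hs1) (h.rapidDecay hφ)
      (hb1.rapidDecay hs1) (hb2.rapidDecay hs2) hr
    have e1 := h₁ _ M hM hs1 (hb1.mono (by omega)) q r hr
    have e2 := h₂ _ _ (by positivity) (contDiffOn_sq_mul hs2) (hb2.sq_mul ha hM hs2) q r hr
    have hn : r * ‖besselU (ν + q) φ r‖ ≤ c * 2 ^ q * ‖besselU (ν + q) (xInvD φ) r‖ +
        ‖besselU (ν + q) (fun x => (x : ℂ) ^ 2 * xInvD (xInvD φ) x) r‖ := by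
      have : r * ‖besselU (ν + q) φ r‖ = ‖(r : ℂ) * besselU (ν + q) φ r‖ := by
        rw [norm_mul, Complex.norm_real, Real.norm_eq_abs, abs_of_nonneg hr]
      rw [this, key, norm_neg]
      refine (norm_add_le _ _).trans ?_
      gcongr
      rw [norm_mul, Complex.norm_real, Real.norm_eq_abs]
      gcongr
      rw [abs_of_nonneg (by linarith)]
      -- The coefficient grows linearly in `q`; bounding it by `c 2^q` lets the instance with `2R`
      -- absorb it.
      have h2q : (q : ℝ) ≤ 2 ^ q := by exact_mod_cast q.lt_two_pow_self.le
      have h1q : (1 : ℝ) ≤ 2 ^ q := one_le_pow₀ (by norm_num)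
      have hc : 2 * |ν| + 2 ≤ (2 * |ν| + 2) * 2 ^ q := le_mul_of_one_le_right (by positivity) h1q
      have := le_abs_self ν
      simp only [c]
      linarith
    calc r ^ (m + 1) * (R ^ q * ‖besselU (ν + q) φ r‖)
        = r ^ m * R ^ q * (r * ‖besselU (ν + q) φ r‖) := by ring
      _ ≤ r ^ m * R ^ q * (c * 2 ^ q * ‖besselU (ν + q) (xInvD φ) r‖ +
        ‖besselU (ν + q) (fun x => (x : ℂ) ^ 2 * xInvD (xInvD φ) x) r‖) := by gcongr
      _ = c * (r ^ m * ((2 * R) ^ q * ‖besselU (ν + q) (xInvD φ) r‖)) +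
        r ^ m * (R ^ q * ‖besselU (ν + q) (fun x => (x : ℂ) ^ 2 * xInvD (xInvD φ) x) r‖) := by
          rw [mul_pow]; ring
      _ ≤ c * (K₁ * M * weight B (2 * α) q) +
        K₂ * ((1 + 2 * (2 * m : ℕ)) * M) * weight B (2 * α) q := by gcongr
      _ = _ := by ring

/-! ### The transform in chirped coordinates -/

lemma chirp_eq (ν μ θ : ℝ) (ε : ℤˣ) (f : HalfLine → ℂ) (x : ℝ) :
    chirp ν μ θ ε f x =
      cexpSq ((ε : ℤ) * (Real.cot θ / 2)) x * ((x ^ (μ - ν) : ℝ) : ℂ) * zeroExt f x := by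
  rw [chirp, cexpSq]
  congr 3
  push_cast
  ring

lemma cexpSq_add (κ κ' x : ℝ) : cexpSq (κ + κ') x = cexpSq κ x * cexpSq κ' x := by
  rw [cexpSq, cexpSq, cexpSq, ← Complex.exp_add]
  congr 1
  push_cast
  ring

lemma chirp_eq_cexpSq_mul_chirp (ν μ θ : ℝ) (ε η : ℤˣ) (f : HalfLine → ℂ) :
    chirp ν μ θ η f = fun x => cexpSq (((η : ℤ) - (ε : ℤ) : ℝ) * (Real.cot θ / 2)) x *
      chirp ν μ θ ε f x := by
  funext x
  rw [chirp_eq, chirp_eq, ← mul_assoc, ← mul_assoc, ← cexpSq_add]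
  congr 3
  ring

lemma contDiffOn_besselU_sq {φ : ℝ → ℂ} (h : RapidDecay φ) {l c : ℝ} (hl : -1 / 2 ≤ l)
    (hc : 0 < c) : ContDiffOn ℝ ∞ (fun x : ℝ => besselU l φ (c * x ^ 2)) (Ioi 0) :=
  (contDiffOn_besselU h hl).comp (contDiff_const.mul (contDiff_id.pow 2)).contDiffOn
    fun _ hx => mul_pos hc (pow_pos hx 2)

lemma xInvD_besselU_sq {φ : ℝ → ℂ} (h : RapidDecay φ) {l c : ℝ} (hl : -1 / 2 ≤ l)
    (hc : 0 < c) : EqOn (xInvD fun x : ℝ => besselU l φ (c * x ^ 2))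
      ((-(c : ℂ) / 2) • fun x : ℝ => besselU (l + 1) φ (c * x ^ 2)) (Ioi 0) := by
  intro x hx
  have hx0 : 0 < x := hx
  have hx' : (x : ℂ) ≠ 0 := Complex.ofReal_ne_zero.2 (ne_of_gt hx)
  have h1 := (hasDerivAt_besselU hl h (mul_pos hc (pow_pos hx0 2))).scomp x
    ((hasDerivAt_pow 2 x).const_mul c)
  have h2 : deriv (fun x : ℝ => besselU l φ (c * x ^ 2)) x = _ := h1.deriv
  rw [xInvD, h2]
  simp only [Pi.smul_apply, smul_eq_mul, Complex.real_smul]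
  push_cast
  field_simp
  ring

lemma iter_xInvD_besselU_sq {φ : ℝ → ℂ} (h : RapidDecay φ) {l c : ℝ} (hl : -1 / 2 ≤ l)
    (hc : 0 < c) (q : ℕ) : EqOn (xInvD^[q] fun x : ℝ => besselU l φ (c * x ^ 2))
      ((-(c : ℂ) / 2) ^ q • fun x : ℝ => besselU (l + q) φ (c * x ^ 2)) (Ioi 0) := by
  induction q generalizing l with
  | zero => intro x _; simp
  | succ q ih =>
    intro x hx
    rw [Function.iterate_succ_apply, iter_xInvD_congr (xInvD_besselU_sq h hl hc) q hx,
      iter_xInvD_smul, Pi.smul_apply, ih (by linarith) hx]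
    simp only [Pi.smul_apply, smul_eq_mul]
    rw [show l + 1 + q = l + (q + 1 : ℕ) by push_cast; ring, pow_succ]
    ring

lemma pow_mul_norm_iter_xInvD_besselU_le {ν a α B c : ℝ} (hν : -1 / 2 ≤ ν) (ha : 0 < a)
    (hα : 0 ≤ α) (hB : a ^ 2 * 2 ^ (2 * α) ≤ B) (hc : 0 < c) (k : ℕ) :
    ∃ K : ℝ, 0 ≤ K ∧ ∀ (φ : ℝ → ℂ) (M : ℝ), 0 ≤ M → ContDiffOn ℝ ∞ φ (Ioi 0) →
      SeqBound (weight a α) (2 * k) M φ → ∀ (q : ℕ) (x : ℝ), 0 < x →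
        x ^ k * ‖(xInvD^[q] fun x : ℝ => besselU ν φ (c * x ^ 2)) x‖ ≤
          K * M * weight B (2 * α) q := by
  have hR : 0 ≤ c / 2 := by positivity
  obtain ⟨K₀, hK₀, h₀⟩ := pow_mul_norm_besselU_le_weight hν ha hα hB 0 0 hR
  obtain ⟨K₁, hK₁, h₁⟩ := pow_mul_norm_besselU_le_weight hν ha hα hB k 0 hR
  refine ⟨K₀ + (c ^ k)⁻¹ * K₁, by positivity, fun φ M hM hφ h q x hx => ?_⟩
  have hw : weightSum a α 0 = weight a α := funext fun k => weightSum_zero a α k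
  rw [hw] at h₀ h₁
  have hr : 0 ≤ c * x ^ 2 := by positivity
  have e0 := h₀ φ M hM hφ (h.mono (by omega)) q _ hr
  have e1 := h₁ φ M hM hφ h q _ hr
  rw [iter_xInvD_besselU_sq (h.rapidDecay hφ) hν hc q hx, Pi.smul_apply, norm_smul, norm_pow]
  have e2 : ‖(-(c : ℂ) / 2)‖ = c / 2 := by simp [abs_of_pos hc]
  rw [e2]
  set Y := (c / 2) ^ q * ‖besselU (ν + q) φ (c * x ^ 2)‖ with hY
  have hY0 : 0 ≤ Y := by positivity
  -- Only integer powers of `r = cx²` are controlled, so `x^k` is replaced by `1 + x^{2k}`.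
  have hxk : x ^ k ≤ 1 + (c ^ k)⁻¹ * (c * x ^ 2) ^ k := by
    rw [mul_pow, inv_mul_cancel_left₀ (by positivity), ← pow_mul, mul_comm 2 k, pow_mul]
    nlinarith [sq_nonneg (x ^ k - 1)]
  calc x ^ k * Y ≤ (1 + (c ^ k)⁻¹ * (c * x ^ 2) ^ k) * Y := by gcongr
    _ = (c * x ^ 2) ^ 0 * Y + (c ^ k)⁻¹ * ((c * x ^ 2) ^ k * Y) := by ring
    _ ≤ K₀ * M * weight B (2 * α) q + (c ^ k)⁻¹ * (K₁ * M * weight B (2 * α) q) := by gcongr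
    _ = _ := by ring

lemma weight_mono {b b' : ℝ} (hb : 0 ≤ b) (h : b ≤ b') (γ : ℝ) (n : ℕ) :
    weight b γ n ≤ weight b' γ n := by
  rw [weight, weight]
  gcongr

lemma pow_mul_norm_iter_xInvD_cexpSq_besselU_le {ν a α b σ c κ : ℝ} (hν : -1 / 2 ≤ ν)
    (ha : 0 < a) (hα : 0 ≤ α) (hb : a ^ 2 * 2 ^ (2 * α) ≤ b) (hσ : 0 < σ) (hc : 0 < c)
    (hκ : 0 < α ∨ κ = 0) (k : ℕ) :
    ∃ K : ℝ, 0 ≤ K ∧ ∀ (φ : ℝ → ℂ) (M : ℝ), 0 ≤ M → ContDiffOn ℝ ∞ φ (Ioi 0) →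
      SeqBound (weight a α) (2 * k) M φ → ∀ (q : ℕ) (x : ℝ), 0 < x →
        x ^ k * ‖(xInvD^[q] fun x : ℝ => cexpSq κ x * besselU ν φ (c * x ^ 2)) x‖ ≤
          K * M * weight (b + σ) (2 * α) q := by
  have hb0 : 0 < b := lt_of_lt_of_le (by positivity) hb
  obtain ⟨K₀, hK₀, h₀⟩ := pow_mul_norm_iter_xInvD_besselU_le hν ha hα hb hc k
  rcases hκ with hα0 | rfl
  · obtain ⟨K₁, hK₁, h₁⟩ := sum_choose_weight_le (γ := 2 * α) (R := 2 * |κ|) hb0 (by positivity) hσ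
      (by positivity)
    refine ⟨K₀ * K₁, by positivity, fun φ M hM hφ h q x hx => ?_⟩
    have hs := contDiffOn_besselU_sq (h.rapidDecay hφ) hν hc
    calc x ^ k * ‖(xInvD^[q] fun x : ℝ => cexpSq κ x * besselU ν φ (c * x ^ 2)) x‖
        ≤ x ^ k * ∑ j ∈ Finset.range (q + 1), (q.choose j : ℝ) * ((2 * |κ|) ^ (q - j) *
          ‖(xInvD^[j] fun x : ℝ => besselU ν φ (c * x ^ 2)) x‖) :=
          mul_le_mul_of_nonneg_left (norm_iter_xInvD_cexpSq_mul_le κ hs q hx) (by positivity)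
      _ = ∑ j ∈ Finset.range (q + 1), (q.choose j : ℝ) * (2 * |κ|) ^ (q - j) *
          (x ^ k * ‖(xInvD^[j] fun x : ℝ => besselU ν φ (c * x ^ 2)) x‖) := by
          rw [Finset.mul_sum]; exact Finset.sum_congr rfl fun j _ => by ring
      _ ≤ ∑ j ∈ Finset.range (q + 1), (q.choose j : ℝ) * (2 * |κ|) ^ (q - j) *
          (K₀ * M * weight b (2 * α) j) :=
          Finset.sum_le_sum fun j _ =>
            mul_le_mul_of_nonneg_left (h₀ φ M hM hφ h j x hx) (by positivity)
      _ = K₀ * M * ∑ j ∈ Finset.range (q + 1), (q.choose j : ℝ) *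
          ((2 * |κ|) ^ (q - j) * weight b (2 * α) j) := by
          rw [Finset.mul_sum]; exact Finset.sum_congr rfl fun j _ => by ring
      _ ≤ K₀ * M * (K₁ * weight (b + σ) (2 * α) q) :=
          mul_le_mul_of_nonneg_left (h₁ q) (by positivity)
      _ = _ := by ring
  · refine ⟨K₀, hK₀, fun φ M hM hφ h q x hx => ?_⟩
    have e : (fun x : ℝ => cexpSq 0 x * besselU ν φ (c * x ^ 2)) =
        fun x : ℝ => besselU ν φ (c * x ^ 2) := by
      funext x; simp [cexpSq]
    rw [e]
    exact (h₀ φ M hM hφ h q x hx).trans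
      (mul_le_mul_of_nonneg_left (weight_mono hb0.le (by linarith) _ _) (by positivity))

/-! ### Bounds from the seminorms of the domain -/

lemma H1.pow_mul_norm_le_seminorm {ν μ θ α A : ℝ} (hA : 0 ≤ A) {S : Set ℤˣ} (ε : S) (q : ℕ)
    (δ : Ioi (0 : ℝ)) (f : H1 ν μ θ α A S) (k : ℕ) (x : HalfLine) :
    (x : ℝ) ^ k * ‖chirpDeriv ν μ θ ε q f x‖ ≤
      H1.seminorms ν μ θ α A S (ε, q, δ) f * weight (A + δ) α k := by
  have hδ : (0 : ℝ) < δ := δ.2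
  have hx : (0 : ℝ) < x := x.2
  have hw : 0 < weight (A + δ) α k := weight_pos (by linarith) _ _
  obtain ⟨C, hC⟩ := f.2 ε ε.2 q δ δ.2
  have hbdd : BddAbove (range fun i : ℕ × HalfLine =>
      ‖(((i.2 : ℝ) ^ i.1 / weight (A + δ) α i.1 : ℝ) : ℂ) • chirpDeriv ν μ θ ε q f i.2‖) := by
    refine ⟨|C|, ?_⟩
    rintro _ ⟨i, rfl⟩
    exact norm_quot_le (pow_nonneg (le_of_lt i.2.2) _) (hC i.1 i.2)
  have h : ‖(((x : ℝ) ^ k / weight (A + δ) α k : ℝ) : ℂ) • chirpDeriv ν μ θ ε q f x‖ ≤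
      H1.seminorms ν μ θ α A S (ε, q, δ) f := le_ciSup hbdd (k, x)
  rw [norm_smul, Complex.norm_real, Real.norm_eq_abs, abs_of_pos (by positivity),
    div_mul_eq_mul_div, div_le_iff₀ hw] at h
  exact h

/-- One sign in `S` suffices to control the chirp of either sign `η`: the two differ by a factor
`e^{iκx²}`, which costs `(1 + 2|κ|)^N` for `N` derivatives and leaves the weights in `k` unchanged.
-/
lemma H1.exists_seqBound {ν μ θ α A δ : ℝ} (hA : 0 ≤ A) {S : Set ℤˣ} (hS : S.Nonempty)
    (hδ : 0 < δ) (η : ℤˣ) (N : ℕ) :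
    ∃ (s : Finset (S × ℕ × Ioi (0 : ℝ))) (K : ℝ), 0 ≤ K ∧ ∀ f : H1 ν μ θ α A S,
      SeqBound (weight (A + δ) α) N (K * s.sup (H1.seminorms ν μ θ α A S) f)
        (chirp ν μ θ η f) := by
  classical
  obtain ⟨ε, hε⟩ := hS
  set s : Finset (S × ℕ × Ioi (0 : ℝ)) :=
    (Finset.range (N + 1)).image fun j => (⟨ε, hε⟩, j, ⟨δ, hδ⟩)
  set κ : ℝ := ((η : ℤ) - (ε : ℤ) : ℝ) * (Real.cot θ / 2)
  have hw : ∀ k, 0 < weight (A + δ) α k := weight_pos (by linarith) _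
  refine ⟨s, (1 + 2 * |κ|) ^ N, by positivity, fun f => ?_⟩
  rw [chirp_eq_cexpSq_mul_chirp ν μ θ ε η]
  refine SeqBound.cexpSq_mul (fun k => (hw k).le) (apply_nonneg _ f) ?_
    (chirp_smooth ν μ θ ε (H1.toSmooth f).2) κ
  intro j hj k x hx
  refine (H1.pow_mul_norm_le_seminorm hA ⟨ε, hε⟩ j ⟨δ, hδ⟩ f k ⟨x, hx⟩).trans ?_
  refine mul_le_mul_of_nonneg_right ?_ (hw k).le
  exact Seminorm.le_finset_sup_apply
    (Finset.mem_image.2 ⟨j, Finset.mem_range.2 (by omega), rfl⟩)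

lemma H1.rapidDecay_chirp {ν μ θ α A : ℝ} (hA : 0 ≤ A) {S : Set ℤˣ} (hS : S.Nonempty) (η : ℤˣ)
    (f : H1 ν μ θ α A S) : RapidDecay (chirp ν μ θ η f) := by
  obtain ⟨s, K, -, h⟩ := H1.exists_seqBound (ν := ν) (μ := μ) (θ := θ) (α := α) hA hS one_pos η 0
  exact (h f).rapidDecay (chirp_smooth ν μ θ η (H1.toSmooth f).2)

/-- For `0 ≤ δ ≤ 1` one has `(A+δ)² ≤ A² + δ(2A+1)`, which dictates the choice of `δ`. The estimate
itself produces `2^{2α}`; the extra `e^{2α}` is pure slack. -/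
lemma exists_sq_mul_le {A α σ : ℝ} (hA : 0 ≤ A) (hα : 0 ≤ α) (hσ : 0 < σ) :
    ∃ δ : ℝ, 0 < δ ∧
      (A + δ) ^ 2 * 2 ^ (2 * α) ≤ A ^ 2 * (2 * Real.exp 1) ^ (2 * α) + σ := by
  set D : ℝ := (2 * A + 1) * 2 ^ (2 * α)
  have hD : 0 < D := by positivity
  refine ⟨min 1 (σ / D), lt_min one_pos (by positivity), ?_⟩
  set δ := min 1 (σ / D)
  have hδ0 : 0 ≤ δ := le_min zero_le_one (by positivity)
  have hδ1 : δ ≤ 1 := min_le_left _ _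
  have hδ2 : δ * D ≤ σ := (le_div_iff₀ hD).1 (min_le_right _ _)
  have h1 : (2 : ℝ) ^ (2 * α) ≤ (2 * Real.exp 1) ^ (2 * α) := by
    refine Real.rpow_le_rpow (by norm_num) ?_ (by positivity)
    linarith [Real.add_one_le_exp 1]
  calc (A + δ) ^ 2 * 2 ^ (2 * α) ≤ (A ^ 2 + δ * (2 * A + 1)) * 2 ^ (2 * α) := by
        gcongr; nlinarith
    _ = A ^ 2 * 2 ^ (2 * α) + δ * D := by simp only [D]; ring
    _ ≤ _ := by gcongr

/-! ### Transforms with a chirped Bessel kernel -/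

/-- `k` is a kernel of the form `D e^{ηiw²cot θ/2} w^{ν-μ} G_ν(c t² w²) t^{2ν+1}`, up to the factor
that turns `f` into its chirp of sign `η`. -/
def IsChirpKernel (ν μ θ : ℝ) (η : ℤˣ) (D : ℂ) (c : ℝ) (k : ℝ → ℝ → ℂ) : Prop :=
  ∀ (f : HalfLine → ℂ) (t w : ℝ), 0 < t → 0 < w → k t w * zeroExt f t =
    D * cexpSq ((η : ℤ) * (Real.cot θ / 2)) w * ((w ^ (ν - μ) : ℝ) : ℂ) *
      (((besselG ν (c * w ^ 2 * t ^ 2) * t ^ (2 * ν + 1) : ℝ) : ℂ) * chirp ν μ θ η f t)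

section

variable {ν μ θ α A c : ℝ} {η : ℤˣ} {D : ℂ} {k : ℝ → ℝ → ℂ} {S : Set ℤˣ}

lemma IsChirpKernel.integral_eq (hk : IsChirpKernel ν μ θ η D c k) (f : HalfLine → ℂ) {w : ℝ}
    (hw : 0 < w) : ∫ t in Ioi (0 : ℝ), k t w * zeroExt f t =
      D * cexpSq ((η : ℤ) * (Real.cot θ / 2)) w * ((w ^ (ν - μ) : ℝ) : ℂ) *
        besselU ν (chirp ν μ θ η f) (c * w ^ 2) := by
  rw [setIntegral_congr_fun measurableSet_Ioi fun t ht => hk f t w ht hw, integral_const_mul]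
  rfl

lemma IsChirpKernel.integrableOn (hk : IsChirpKernel ν μ θ η D c k) (hν : -1 / 2 ≤ ν)
    (hc : 0 < c) (hA : 0 ≤ A) (hS : S.Nonempty) (f : H1 ν μ θ α A S) {w : ℝ} (hw : 0 < w) :
    IntegrableOn (fun t => k t w * zeroExt f t) (Ioi 0) := by
  have h := (integrableOn_besselU hν (p := 2 * ν + 1) (by linarith)
    (H1.rapidDecay_chirp hA hS η f) (r := c * w ^ 2) (by positivity)).const_mul
    (D * cexpSq ((η : ℤ) * (Real.cot θ / 2)) w * ((w ^ (ν - μ) : ℝ) : ℂ))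
  exact IntegrableOn.congr_fun h (fun t ht => (hk f t w ht hw).symm) measurableSet_Ioi

/-- The integral transform with kernel `k`. -/
def kernelTransform (k : ℝ → ℝ → ℂ) (f : HalfLine → ℂ) (w : HalfLine) : ℂ :=
  ∫ t in Ioi (0 : ℝ), k t w * zeroExt f t

lemma zeroExt_apply (f : HalfLine → ℂ) {x : ℝ} (hx : 0 < x) : zeroExt f x = f ⟨x, hx⟩ := by
  rw [zeroExt, dif_pos (mem_Ioi.2 hx)]

lemma IsChirpKernel.kernelTransform_mem (hk : IsChirpKernel ν μ θ η D c k) (hν : -1 / 2 ≤ ν)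
    (hc : 0 < c) (hA : 0 ≤ A) (hS : S.Nonempty) (f : H1 ν μ θ α A S) :
    kernelTransform k f ∈ smoothFun := by
  have h1 : ContDiffOn ℝ ∞ (fun x : ℝ => ((x ^ (ν - μ) : ℝ) : ℂ)) (Ioi 0) :=
    Complex.ofRealCLM.contDiff.comp_contDiffOn fun x hx =>
      (Real.contDiffAt_rpow_const_of_ne (ne_of_gt hx)).contDiffWithinAt
  have h2 := ((contDiff_const (c := D)).mul
    (contDiff_cexpSq ((η : ℤ) * (Real.cot θ / 2)))).contDiffOn.mul h1
  refine (h2.mul (contDiffOn_besselU_sq (H1.rapidDecay_chirp hA hS η f) hν hc)).congr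
    fun x hx => ?_
  rw [zeroExt_apply _ hx]
  exact hk.integral_eq f hx

lemma IsChirpKernel.chirp_kernelTransform (hk : IsChirpKernel ν μ θ η D c k) (ε : ℤˣ)
    (f : HalfLine → ℂ) : EqOn (chirp ν μ θ ε (kernelTransform k f))
      (D • fun x => cexpSq (((ε : ℤ) + (η : ℤ) : ℝ) * (Real.cot θ / 2)) x *
        besselU ν (chirp ν μ θ η f) (c * x ^ 2)) (Ioi 0) := by
  intro x hx
  have hx : 0 < x := hx
  have h1 : ((x ^ (μ - ν) : ℝ) : ℂ) * ((x ^ (ν - μ) : ℝ) : ℂ) = 1 := by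
    rw [← Complex.ofReal_mul, ← Real.rpow_add hx]; simp
  rw [chirp_eq, zeroExt_apply _ hx, kernelTransform, hk.integral_eq f hx, Pi.smul_apply,
    smul_eq_mul, add_mul, cexpSq_add]
  linear_combination (cexpSq ((ε : ℤ) * (Real.cot θ / 2)) x *
    cexpSq ((η : ℤ) * (Real.cot θ / 2)) x * D * besselU ν (chirp ν μ θ η f) (c * x ^ 2)) * h1

/-- Half of `σ` pays for enlarging `A` to `A + δ`, the other half for the leftover chirp of rate
`(ε+η) cot θ / 2`. The resulting bound gives both membership in the target space and continuity. -/
lemma IsChirpKernel.exists_bound (hk : IsChirpKernel ν μ θ η D c k) (hν : -1 / 2 ≤ ν)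
    (hc : 0 < c) (hα : 0 ≤ α) (hA : 0 ≤ A) (hS : S.Nonempty) {ε : ℤˣ}
    (hε : 0 < α ∨ θ = Real.pi / 2 ∨ ε = -η) (n : ℕ) {σ : ℝ} (hσ : 0 < σ) :
    ∃ (s : Finset (S × ℕ × Ioi (0 : ℝ))) (K : ℝ), 0 ≤ K ∧
      ∀ (f : H1 ν μ θ α A S) (q : ℕ) (x : HalfLine),
        (x : ℝ) ^ n * ‖chirpDeriv ν μ θ ε q (kernelTransform k f) x‖ ≤
          K * s.sup (H1.seminorms ν μ θ α A S) f *
            weight (A ^ 2 * (2 * Real.exp 1) ^ (2 * α) + σ) (2 * α) q := by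
  obtain ⟨δ, hδ, hδ'⟩ := exists_sq_mul_le hA hα (half_pos hσ)
  have hκ : 0 < α ∨ ((ε : ℤ) + (η : ℤ) : ℝ) * (Real.cot θ / 2) = 0 := by
    rcases hε with h | rfl | rfl
    · exact Or.inl h
    · right; rw [Real.cot_eq_cos_div_sin]; simp
    · right; simp
  obtain ⟨K₁, hK₁, h₁⟩ := pow_mul_norm_iter_xInvD_cexpSq_besselU_le hν (by linarith : 0 < A + δ)
    hα hδ' (half_pos hσ) hc hκ n
  obtain ⟨s, K₂, hK₂, h₂⟩ := H1.exists_seqBound (ν := ν) (μ := μ) (θ := θ) (α := α) hA hS hδ η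
    (2 * n)
  refine ⟨s, ‖D‖ * K₁ * K₂, by positivity, fun f q x => ?_⟩
  have hx : (0 : ℝ) < x := x.2
  have e := h₁ _ _ (mul_nonneg hK₂ (apply_nonneg _ f)) (chirp_smooth ν μ θ η (H1.toSmooth f).2)
    (h₂ f) q x hx
  rw [add_assoc, add_halves] at e
  rw [chirpDeriv, iter_xInvD_congr (hk.chirp_kernelTransform ε f) q hx, iter_xInvD_smul,
    Pi.smul_apply, norm_smul, mul_left_comm]
  refine (mul_le_mul_of_nonneg_left e (norm_nonneg D)).trans (le_of_eq ?_)
  ring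

lemma IsChirpKernel.exists_continuousLinearMap (hk : IsChirpKernel ν μ θ η D c k)
    (hν : -1 / 2 ≤ ν) (hc : 0 < c) (hα : 0 ≤ α) (hA : 0 ≤ A) (hS : S.Nonempty) {T : Set ℤˣ}
    (hT : 0 < α ∨ θ = Real.pi / 2 ∨ T = {-η}) :
    ∃ Φ : H1 ν μ θ α A S →L[ℂ] H2 ν μ θ (2 * α) (A ^ 2 * (2 * Real.exp 1) ^ (2 * α)) T,
      ∀ (f : H1 ν μ θ α A S) (w : HalfLine),
        IntegrableOn (fun t : ℝ => k t w * zeroExt f t) (Ioi 0) ∧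
        Φ f w = ∫ t in Ioi (0 : ℝ), k t w * zeroExt f t := by
  have hb : ∀ ε ∈ T, ∀ (n : ℕ) {σ : ℝ}, 0 < σ → _ := fun ε hε n σ hσ =>
    hk.exists_bound (S := S) (ε := ε) hν hc hα hA hS (hT.imp_right (Or.imp_right fun h => by
      rw [h] at hε; exact hε)) n hσ
  have hB : 0 ≤ A ^ 2 * (2 * Real.exp 1) ^ (2 * α) := by positivity
  let L : H1 ν μ θ α A S →ₗ[ℂ] H2 ν μ θ (2 * α) (A ^ 2 * (2 * Real.exp 1) ^ (2 * α)) T :=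
    { toFun := fun f => ⟨⟨kernelTransform k f, hk.kernelTransform_mem hν hc hA hS f⟩,
        fun ε hε n σ hσ => by
          obtain ⟨s, K, -, h⟩ := hb ε hε n hσ
          exact ⟨_, h f⟩⟩
      map_add' := fun f g => by
        refine Subtype.ext (Subtype.ext (funext fun w => ?_))
        change kernelTransform k ((f : HalfLine → ℂ) + (g : HalfLine → ℂ)) w =
          kernelTransform k f w + kernelTransform k g w
        rw [kernelTransform, kernelTransform, kernelTransform, zeroExt_add,
          ← integral_add (hk.integrableOn hν hc hA hS f w.2) (hk.integrableOn hν hc hA hS g w.2)]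
        simp only [Pi.add_apply, mul_add]
      map_smul' := fun a f => by
        refine Subtype.ext (Subtype.ext (funext fun w => ?_))
        change kernelTransform k (a • (f : HalfLine → ℂ)) w = a • kernelTransform k f w
        rw [kernelTransform, kernelTransform, zeroExt_smul, ← integral_smul]
        simp only [Pi.smul_apply, smul_eq_mul, mul_left_comm] }
  have hL : Seminorm.IsBounded (H1.seminorms ν μ θ α A S)
      (H2.seminorms ν μ θ (2 * α) (A ^ 2 * (2 * Real.exp 1) ^ (2 * α)) T) L := by
    rintro ⟨ε, n, σ⟩
    have hσ : (0 : ℝ) < σ := σ.2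
    obtain ⟨s, K, hK, h⟩ := hb ε ε.2 n hσ
    refine ⟨s, ⟨K, hK⟩, fun f => ?_⟩
    change (⨆ i : ℕ × HalfLine, ‖(((i.2 : ℝ) ^ n /
      weight (A ^ 2 * (2 * Real.exp 1) ^ (2 * α) + σ) (2 * α) i.1 : ℝ) : ℂ) •
      chirpDeriv ν μ θ ε i.1 (kernelTransform k f) i.2‖) ≤
        K * s.sup (H1.seminorms ν μ θ α A S) f
    refine Real.iSup_le (fun i => ?_) (mul_nonneg hK (apply_nonneg _ f))
    have hx : (0 : ℝ) < i.2 := i.2.2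
    have hw := weight_pos (by linarith : 0 < A ^ 2 * (2 * Real.exp 1) ^ (2 * α) + σ) (2 * α) i.1
    rw [norm_smul, Complex.norm_real, Real.norm_eq_abs, abs_of_pos (by positivity),
      div_mul_eq_mul_div, div_le_iff₀ hw]
    exact h f i.1 i.2
  refine ⟨⟨L, WithSeminorms.continuous_of_isBounded (H1.withSeminorms ν μ θ α A S)
    (H2.withSeminorms ν μ θ _ _ T) L hL⟩, fun f w => ⟨hk.integrableOn hν hc hA hS f w.2, rfl⟩⟩

end

/-! ### The fractional Hankel kernels -/

/-- The powers of `t` regroup as `t^{ν-μ} t^{1+2μ} = t^{2ν+1} t^{μ-ν}`, and the last factor, with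
the exponential in `t`, is what turns `f` into its chirp of sign `+1`. -/
lemma isChirpKernel_kernel (ν μ : ℝ) {θ : ℝ} (hθ : θ ∈ Ioo 0 Real.pi) :
    IsChirpKernel ν μ θ 1
      (hankelConst ν μ θ * ((2 ^ (-ν) * (Real.sin θ)⁻¹ ^ (ν - μ) : ℝ) : ℂ))
      ((Real.sin θ)⁻¹ ^ 2) (kernel ν μ θ) := by
  intro f t w ht hw
  have hs : 0 < (Real.sin θ)⁻¹ := inv_pos.2 (Real.sin_pos_of_mem_Ioo hθ)
  set c := (Real.sin θ)⁻¹
  have hz : 0 < t * w * c := by positivity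
  have e1 : Complex.exp (Complex.I / 2 * (((t ^ 2 + w ^ 2) * Real.cot θ : ℝ) : ℂ)) =
      cexpSq (Real.cot θ / 2) w * cexpSq (Real.cot θ / 2) t := by
    rw [cexpSq, cexpSq, ← Complex.exp_add]
    congr 1
    push_cast
    ring
  have e2 : (t * w * c) ^ (-μ) * besselJ ν (t * w * c) * t ^ (1 + 2 * μ) =
      2 ^ (-ν) * c ^ (ν - μ) * w ^ (ν - μ) *
        (besselG ν (c ^ 2 * w ^ 2 * t ^ 2) * t ^ (2 * ν + 1)) * t ^ (μ - ν) := by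
    rw [besselJ_eq ν hz, Real.div_rpow hz.le (by norm_num),
      show (t * w * c) ^ 2 = c ^ 2 * w ^ 2 * t ^ 2 by ring,
      Real.rpow_neg (by norm_num : (0 : ℝ) ≤ 2)]
    have h1 : (t * w * c) ^ (-μ) * (t * w * c) ^ ν = t ^ (ν - μ) * w ^ (ν - μ) * c ^ (ν - μ) := by
      rw [← Real.rpow_add hz, ← Real.mul_rpow ht.le hw.le, ← Real.mul_rpow (by positivity) hs.le]
      congr 1; ring
    have h2 : t ^ (ν - μ) * t ^ (1 + 2 * μ) = t ^ (2 * ν + 1) * t ^ (μ - ν) := by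
      rw [← Real.rpow_add ht, ← Real.rpow_add ht]; congr 1; ring
    linear_combination ((2 ^ ν)⁻¹ * besselG ν (c ^ 2 * w ^ 2 * t ^ 2) * t ^ (1 + 2 * μ)) * h1 +
      (w ^ (ν - μ) * c ^ (ν - μ) * (2 ^ ν)⁻¹ * besselG ν (c ^ 2 * w ^ 2 * t ^ 2)) * h2
  rw [kernel, e1, e2, chirp_eq]
  simp only [Units.val_one, Int.cast_one, one_mul]
  push_cast
  ring

lemma conj_cexpSq (κ x : ℝ) : (starRingEnd ℂ) (cexpSq κ x) = cexpSq (-κ) x := by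
  rw [cexpSq, cexpSq, ← Complex.exp_conj]
  congr 1
  simp

/-- Everything except `D` and the exponentials is real, so conjugation only flips the chirp sign.
The defining identity is linear in the value of `f` at `t`, so it is enough to conjugate it for `f =
1`. -/
lemma IsChirpKernel.conj {ν μ θ c : ℝ} {η : ℤˣ} {D : ℂ} {k : ℝ → ℝ → ℂ}
    (hk : IsChirpKernel ν μ θ η D c k) :
    IsChirpKernel ν μ θ (-η) ((starRingEnd ℂ) D) c fun t w => (starRingEnd ℂ) (k t w) := by
  intro f t w ht hw
  have h := congrArg (starRingEnd ℂ) (hk (fun _ => 1) t w ht hw)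
  rw [chirp_eq, zeroExt_apply _ ht] at h
  simp only [map_mul, mul_one, conj_cexpSq, Complex.conj_ofReal] at h
  have e : (((-η : ℤˣ) : ℤ) : ℝ) * (Real.cot θ / 2) = -((η : ℤ) * (Real.cot θ / 2)) := by
    push_cast; ring
  change (starRingEnd ℂ) (k t w) * zeroExt f t = _
  rw [h, chirp_eq, e]
  ring

end FracHankel

end

theorem theorem2p1 (ν μ θ α A : ℝ) (hν : -1 / 2 ≤ ν) (hθ : θ ∈ Set.Ioo 0 Real.pi)
    (hα : 0 ≤ α) (hA : 0 ≤ A) (S T : Set ℤˣ) (hS : S.Nonempty) (hT : T.Nonempty) :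
    ((0 < α ∨ θ = Real.pi / 2 ∨ T = {1}) →
      ∃ Φ : FracHankel.H1 ν μ θ α A S →L[ℂ]
          FracHankel.H2 ν μ θ (2 * α) (A ^ 2 * (2 * Real.exp 1) ^ (2 * α)) T,
        ∀ (f : FracHankel.H1 ν μ θ α A S) (t : FracHankel.HalfLine),
          MeasureTheory.IntegrableOn
            (fun w : ℝ => FracHankel.invKernel ν μ θ w t * FracHankel.zeroExt f w)
            (Set.Ioi 0) ∧
          Φ f t = FracHankel.invHankel ν μ θ f t) ∧
    ((0 < α ∨ θ = Real.pi / 2 ∨ T = {-1}) →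
      ∃ Φ : FracHankel.H1 ν μ θ α A S →L[ℂ]
          FracHankel.H2 ν μ θ (2 * α) (A ^ 2 * (2 * Real.exp 1) ^ (2 * α)) T,
        ∀ (f : FracHankel.H1 ν μ θ α A S) (w : FracHankel.HalfLine),
          MeasureTheory.IntegrableOn
            (fun t : ℝ => FracHankel.kernel ν μ θ t w * FracHankel.zeroExt f t)
            (Set.Ioi 0) ∧
          Φ f w = FracHankel.hankel ν μ θ f w) := by
  have hk := FracHankel.isChirpKernel_kernel ν μ hθ
  have hc : 0 < (Real.sin θ)⁻¹ ^ 2 := pow_pos (inv_pos.2 (Real.sin_pos_of_mem_Ioo hθ)) 2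
  -- The inverse kernel has `η = -1`, so the chirps cancel for `ε = -η = 1`; the forward kernel has
  -- `η = 1` and needs `ε = -1`.
  exact ⟨fun h => hk.conj.exists_continuousLinearMap hν hc hα hA hS (by simpa using h),
    fun h => hk.exists_continuousLinearMap hν hc hα hA hS h⟩
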